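/- Let $\delta\in\mathbb R\setminus\{0\}$, $\sigma>0$, let $X_1,X_2,\dots$ be i.i.d. $N(\delta,\sigma^2)$ random variables, $S_n=X_1+\dots+X_n$, $d=|\delta|$ and $q=\delta^2/(2\sigma^2)$. Let $R=\inf\{n\ge 1: S_n<0\}$ (with $\inf\emptyset=\infty$) be the first strictly descending ladder epoch, $r(z)=\sum_{n\ge 1}\mathbb P(R=n)\,z^n$ its generating function, and $Z_0=\sum_{n=1}^\infty 1_{(-\infty,0)}(S_n)$ the occupation time of the negative half-line. Let $A$ be a random variable whose law has the density $$4\,\frac{\varphi(\sqrt{2t})}{\sqrt{2t}}-4\,\Phi(-\sqrt{2t}),\qquad t>0,$$ where $\varphi$ and $\Phi$ are the density and the distribution function of $N(0,1)$. This is a probability law on $(0,\infty)$, and $\mathbb E e^{-sA}=\dfrac{2}{1+\sqrt{1+s}}$ for all $s\ge 0$. Moreover: (a) For every complex $z$ with $|z|<1$, $$r(z)=1-(1-z)^{1/2}\exp\bigl(\operatorname{sign}(\delta)\,G(z)\bigr),\qquad G(z)=\frac{d^2}{\pi\sigma^2}\int_0^1\!\!\int_0^\infty \frac{z\,e^{-d^2(y^2+x^2)/(2\sigma^2)}}{1-z\,e^{-d^2(y^2+x^2)/(2\sigma^2)}}\,dy\,dx,$$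 where the double integral converges absolutely and the principal branch of the square root is taken. (b) If $\delta>0$, then $Z_0<\infty$ almost surely. If $\delta$ and $\sigma$ vary in such a way that $\delta>0$ and $q\to 0$ (in particular if $\delta\downarrow 0$ and $q\to 0$), then $qZ_0\to A$ in distribution. (c) If $\delta$ and $\sigma$ vary in such a way that $\delta<0$ and $q\to 0$ (in particular if $\delta\uparrow 0$ and $q\to 0$), then for every $s\ge 0$ $$r(e^{-qs})^{1/\sqrt q}\longrightarrow e^{-(\sqrt{1+s}-1)}.$$ -/

import Mathlib

open MeasureTheory ProbabilityTheory Filter Set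
open scoped Topology ENNReal NNReal

noncomputable section

namespace NormalWalk

/-- The variables `X 0, X 1, …` are the i.i.d. steps of a normal random walk: they are independent
and each of them is `N(δ, σ²)`-distributed. -/
structure IsNormalSteps {Ω : Type*} [MeasurableSpace Ω] (P : Measure Ω) (X : ℕ → Ω → ℝ)
    (δ : ℝ) (σ : ℝ≥0) : Prop where
  indep : iIndepFun X P
  law : ∀ i, HasLaw (X i) (gaussianReal δ (σ ^ 2)) P

/-- The partial sums: `walk X n = X 0 + ⋯ + X (n - 1)` is the sum `S_n` of the first `n` steps. -/
def walk {Ω : Type*} (X : ℕ → Ω → ℝ) (n : ℕ) (ω : Ω) : ℝ := ∑ i ∈ Finset.range n, X i ω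

/-- The first strictly descending ladder epoch `R = inf {n ≥ 1 : S_n < 0}`, with `inf ∅ = ∞`. -/
def descendingEpoch {Ω : Type*} (X : ℕ → Ω → ℝ) (ω : Ω) : ℕ∞ :=
  sInf {m : ℕ∞ | ∃ n : ℕ, m = n ∧ 1 ≤ n ∧ walk X n ω < 0}

/-- The generating function `r(z) = ∑ₙ P(R = n) zⁿ` of the (possibly defective) variable `R`,
for a real or complex argument `z`. -/
def epochGenFun {𝕜 : Type*} [RCLike 𝕜] {Ω : Type*} [MeasurableSpace Ω] (P : Measure Ω)
    (X : ℕ → Ω → ℝ) (z : 𝕜) : 𝕜 :=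
  ∑' n : ℕ, ((P.real {ω | descendingEpoch X ω = n} : ℝ) : 𝕜) * z ^ n

/-- The occupation time `Z₀ = ∑_{n ≥ 1} 1_{(-∞, 0)}(S_n)`, with values in `[0, ∞]`. -/
def occupationTime {Ω : Type*} (X : ℕ → Ω → ℝ) (ω : Ω) : ℝ≥0∞ :=
  ∑' n : ℕ, (Iio (0 : ℝ)).indicator (fun _ => 1) (walk X (n + 1) ω)

/-- The parameter `q = δ² / (2σ²)`. -/
def driftRatio (δ : ℝ) (σ : ℝ≥0) : ℝ := δ ^ 2 / (2 * (σ : ℝ) ^ 2)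

/-- The integrand of the double integral, with `d = |δ|`. -/
def kernelG (δ : ℝ) (σ : ℝ≥0) (z : ℂ) (x y : ℝ) : ℂ :=
  z * (Real.exp (-(|δ| ^ 2 * (y ^ 2 + x ^ 2) / (2 * (σ : ℝ) ^ 2))) : ℂ) /
    (1 - z * (Real.exp (-(|δ| ^ 2 * (y ^ 2 + x ^ 2) / (2 * (σ : ℝ) ^ 2))) : ℂ))

/-- `G(z) = d² / (π σ²) ∫₀¹ ∫₀^∞ z e^{-d²(y²+x²)/(2σ²)} / (1 - z e^{-d²(y²+x²)/(2σ²)}) dy dx`. -/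
def funG (δ : ℝ) (σ : ℝ≥0) (z : ℂ) : ℂ :=
  ((|δ| ^ 2 / (Real.pi * (σ : ℝ) ^ 2) : ℝ) : ℂ) *
    ∫ x in Ioo (0 : ℝ) 1, ∫ y in Ioi (0 : ℝ), kernelG δ σ z x y

/-- The law of `A`: its density is `4 φ(√(2t)) / √(2t) - 4 Φ(-√(2t))` for `t > 0`, where `φ` and `Φ`
are the density and the distribution function of `N(0, 1)`. -/
def lawA : Measure ℝ :=
  (volume.restrict (Ioi (0 : ℝ))).withDensity fun t =>
    ENNReal.ofReal (4 * gaussianPDFReal 0 1 (√(2 * t)) / √(2 * t)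
      - 4 * cdf (gaussianReal 0 1) (-√(2 * t)))

end NormalWalk

end

noncomputable section

namespace NormalWalk

/-! ### Paths, partial sums and the rearrangement -/

/-! The engine is a rearrangement of paths. Going through the first `n` steps in order, each step
that ends at a negative partial sum is moved to the front. The number `N_n` of negative partial sums
of the old path is then the time of the first minimum of the new one (`isFirstMin_negFirst`). The
rearrangement preserves the i.i.d. law, although it depends on the path
(`measurePreserving_negFirst`). A path splits into independent pieces at its first minimum, so P(N_n
= k) = u_k v_{n-k}, where u_k is the probability that k is a strict descending ladder index and v_m
the probability of staying nonnegative up to time m.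

Let U, V be the generating functions of u, v, let p_n = P(S_n < 0) and L(z) = ∑ p_n zⁿ / n. Total
mass one gives U V = 1/(1-z). The mean of N_n is p_1 + ⋯ + p_n, which gives z U' V = (∑ p_n
zⁿ)/(1-z). Hence U' = U L', so U = exp L and r = 1 - (1-z) V = 1 - exp(-L): this is
`tsum_epochProb`.

For normal steps p_n is Φ(-√(2qn)) or its complement. Splitting off 1/2 turns exp(-L) into
(1-z)^{1/2} exp(± ∑ (1/2 - Φ(-√(2qn))) zⁿ/n). Expanding the kernel of G geometrically and
integrating term by term shows that this series is G (`funG_eq_coreSeries`), which is (a).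

For positive drift ∑ p_n < ∞. Letting n → ∞ in the law of N_n gives E w^{Z₀} = exp(L(w) - L(1)) for
|w| ≤ 1. At w = e^{iξq} the exponent is, up to sign, a Riemann sum of mesh q for ∫ (1 - e^{iξt}) t⁻¹
Φ(-√(2t)) dt. With s = -iξ this integral is log((1 + √(1+s))/2) (`limitExponent_eq`), so the limit
is the characteristic function of A, and Lévy's continuity theorem gives (b).

For negative drift the series at z = e^{-qs} is a Riemann sum with limit arsinh(1/√s), while √(1-z)
is asymptotic to √(qs). So r = 1 - √q (√(1+s) - 1) + o(√q), and the power 1/√q yields (c). -/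

/-- Partial sums of a path. -/
def psum (x : ℕ → ℝ) (n : ℕ) : ℝ := ∑ i ∈ Finset.range n, x i

@[simp] lemma psum_zero (x : ℕ → ℝ) : psum x 0 = 0 := by simp [psum]

lemma psum_succ (x : ℕ → ℝ) (n : ℕ) : psum x (n + 1) = psum x n + x n := by
  simp [psum, Finset.sum_range_succ]

lemma psum_add (x : ℕ → ℝ) (k m : ℕ) :
    psum x (k + m) = psum x k + psum (fun i => x (k + i)) m := by
  simp [psum, Finset.sum_range_add]

/-- The index map that moves position `n` to the front. -/
def rotIndex (n i : ℕ) : ℕ := if i = 0 then n else if i ≤ n then i - 1 else i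

lemma rotIndex_injective (n : ℕ) : Function.Injective (rotIndex n) := by
  intro i j h
  unfold rotIndex at h
  split_ifs at h <;> omega

/-- Move the `n`-th step of a path to the front. -/
def rotate (n : ℕ) (x : ℕ → ℝ) : ℕ → ℝ := fun i => x (rotIndex n i)

lemma psum_rotate_succ (n : ℕ) (x : ℕ → ℝ) {k : ℕ} (hk : k ≤ n) :
    psum (rotate n x) (k + 1) = x n + psum x k := by
  induction k with
  | zero => simp [psum, rotate, rotIndex]
  | succ k ih =>
    rw [psum_succ, ih (by omega), psum_succ]
    simp [rotate, rotIndex, hk, add_assoc]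

lemma psum_rotate (n : ℕ) (x : ℕ → ℝ) : psum (rotate n x) (n + 1) = psum x (n + 1) := by
  rw [psum_rotate_succ n x le_rfl, psum_succ, add_comm]

/-- The rearrangement that brings the steps ending at a negative partial sum to the front. -/
def negFirst : ℕ → (ℕ → ℝ) → ℕ → ℝ
  | 0, x => x
  | n + 1, x => if psum (negFirst n x) (n + 1) < 0 then rotate n (negFirst n x) else negFirst n x

lemma negFirst_of_le {n i : ℕ} (x : ℕ → ℝ) (h : n ≤ i) : negFirst n x i = x i := by
  induction n with
  | zero => rfl
  | succ n ih =>
    rw [negFirst]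
    split_ifs
    · rw [rotate, rotIndex, if_neg (by omega), if_neg (by omega), ih (by omega)]
    · exact ih (by omega)

lemma psum_negFirst (n : ℕ) (x : ℕ → ℝ) : psum (negFirst n x) n = psum x n := by
  induction n with
  | zero => simp
  | succ n ih =>
    rw [negFirst]
    split_ifs
    · rw [psum_rotate, psum_succ, psum_succ, ih, negFirst_of_le x le_rfl]
    · rw [psum_succ, psum_succ, ih, negFirst_of_le x le_rfl]

/-- The number of negative partial sums among the first `n`. -/
def negCount (n : ℕ) (x : ℕ → ℝ) : ℕ := ∑ k ∈ Finset.range n, if psum x (k + 1) < 0 then 1 else 0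

lemma negCount_succ (n : ℕ) (x : ℕ → ℝ) :
    negCount (n + 1) x = negCount n x + if psum x (n + 1) < 0 then 1 else 0 := by
  rw [negCount, negCount, Finset.sum_range_succ]

/-- The first minimum of the partial sums up to time `n` is attained at time `k`. -/
def IsFirstMin (n k : ℕ) (x : ℕ → ℝ) : Prop :=
  k ≤ n ∧ (∀ i < k, psum x k < psum x i) ∧ ∀ i, k ≤ i → i ≤ n → psum x k ≤ psum x i

lemma IsFirstMin.unique {n k l : ℕ} {x : ℕ → ℝ} (hk : IsFirstMin n k x) (hl : IsFirstMin n l x) :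
    k = l := by
  rcases lt_trichotomy k l with h | h | h
  · exact absurd (hl.2.1 k h) (not_lt.2 (hk.2.2 l h.le hl.1))
  · exact h
  · exact absurd (hk.2.1 l h) (not_lt.2 (hl.2.2 k h.le hk.1))

lemma isFirstMin_negFirst (n : ℕ) (x : ℕ → ℝ) : IsFirstMin n (negCount n x) (negFirst n x) := by
  induction n with
  | zero =>
    refine ⟨le_rfl, fun i hi => absurd hi (by simp [negCount]), fun i _ hi => ?_⟩
    simp [negCount, Nat.le_zero.1 hi]
  | succ n ih =>
    obtain ⟨h1, h2, h3⟩ := ih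
    have hS : psum (negFirst n x) (n + 1) = psum x (n + 1) := by
      rw [psum_succ, psum_succ, psum_negFirst, negFirst_of_le x le_rfl]
    rw [negCount_succ, negFirst, hS]
    split_ifs with hneg
    -- After the rotation the old path reappears one step later, raised by its last step. The old
    -- minimum is at most the old endpoint, so the shifted minimum is at most the negative S_{n+1},
    -- and it beats the new starting value 0.
    · have key : psum (rotate n (negFirst n x)) (negCount n x + 1) < 0 := by
        rw [psum_rotate_succ _ _ h1]
        have := h3 n h1 le_rfl
        rw [← hS, psum_succ] at hneg
        linarith
      refine ⟨by omega, fun i hi => ?_, fun i hi hin => ?_⟩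
      · cases i with
        | zero => simpa using key
        | succ i =>
          rw [psum_rotate_succ _ _ h1, psum_rotate_succ _ _ (by omega)]
          linarith [h2 i (by omega)]
      · cases i with
        | zero => omega
        | succ i =>
          rw [psum_rotate_succ _ _ h1, psum_rotate_succ _ _ (by omega)]
          linarith [h3 i (by omega) (by omega)]
    · refine ⟨by omega, h2, fun i hi hin => ?_⟩
      rcases Nat.lt_or_ge n i with h | h
      · obtain rfl : i = n + 1 := by omega
        -- Time 0 competes for the minimum, so the minimum is at most 0 and a nonnegative new
        -- endpoint cannot undercut it.
        have h0 : psum (negFirst n x) (negCount n x) ≤ 0 := by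
          rcases Nat.eq_zero_or_pos (negCount n x) with h | h
          · simp [h]
          · simpa using (h2 0 h).le
        rw [hS]
        exact h0.trans (not_lt.1 hneg)
      · exact h3 i hi h

lemma isFirstMin_negFirst_iff (n k : ℕ) (x : ℕ → ℝ) :
    IsFirstMin n k (negFirst n x) ↔ negCount n x = k :=
  ⟨fun h => (isFirstMin_negFirst n x).unique h, fun h => h ▸ isFirstMin_negFirst n x⟩

/-- This separates the event into a condition on the first k steps and one on the later steps, which
makes independence applicable. -/
lemma isFirstMin_add_iff (k m : ℕ) (x : ℕ → ℝ) :
    IsFirstMin (k + m) k x ↔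
      IsFirstMin k k x ∧ ∀ i ≤ m, 0 ≤ psum (fun j => x (k + j)) i := by
  constructor
  · rintro ⟨_, h2, h3⟩
    refine ⟨⟨le_rfl, h2, fun i hi hi' => by rw [le_antisymm hi hi']⟩, fun i hi => ?_⟩
    have := h3 (k + i) (by omega) (by omega)
    rw [psum_add] at this
    linarith
  · rintro ⟨⟨_, h2, _⟩, h⟩
    refine ⟨by omega, h2, fun i hi hi' => ?_⟩
    obtain ⟨j, rfl⟩ := Nat.exists_eq_add_of_le hi
    rw [psum_add]
    linarith [h j (by omega)]

/-! ### The law of an i.i.d. path -/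

/-- The law of a sequence of independent variables with common law `μ`. -/
abbrev iid (μ : Measure ℝ) : Measure (ℕ → ℝ) := Measure.infinitePi fun _ => μ

section

variable (μ : Measure ℝ) [IsProbabilityMeasure μ]

lemma iIndepFun_iid : iIndepFun (fun (i : ℕ) (x : ℕ → ℝ) => x i) (iid μ) :=
  iIndepFun_infinitePi (X := fun _ x => x) (fun _ => measurable_id)

lemma measurePreserving_reindex {g : ℕ → ℕ} (hg : g.Injective) :
    MeasurePreserving (fun (x : ℕ → ℝ) i => x (g i)) (iid μ) (iid μ) := by
  refine ⟨by fun_prop, ?_⟩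
  have := ((iIndepFun_iid μ).precomp hg).map_fun_eq_infinitePi_map (fun i => by fun_prop)
  refine this.trans ?_
  congr 1
  ext1 i
  exact (measurePreserving_eval_infinitePi (fun _ : ℕ => μ) (g i)).map_eq

lemma measurePreserving_rotate (n : ℕ) : MeasurePreserving (rotate n) (iid μ) (iid μ) :=
  measurePreserving_reindex μ (rotIndex_injective n)

@[fun_prop]
lemma measurable_psum (n : ℕ) : Measurable fun x : ℕ → ℝ => psum x n := by
  unfold psum; fun_prop

/-- A map glued from two measure-preserving maps need not preserve measure. It does here because
both pull the same set `B` back to the switching event, so the images of the two branches do not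
overlap. -/
lemma _root_.MeasureTheory.MeasurePreserving.ite {α β : Type*} [MeasurableSpace α]
    [MeasurableSpace β] {μ : Measure α} {ν : Measure β} {f g : α → β}
    (hf : MeasurePreserving f μ ν) (hg : MeasurePreserving g μ ν) {p : α → Prop} [DecidablePred p]
    {B : Set β} (hB : MeasurableSet B) (hfB : ∀ x, f x ∈ B ↔ p x) (hgB : ∀ x, g x ∈ B ↔ p x) :
    MeasurePreserving (fun x => if p x then f x else g x) μ ν := by
  have hp : MeasurableSet {x | p x} := by
    have := hf.measurable hB
    rwa [show f ⁻¹' B = {x | p x} from Set.ext hfB] at this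
  have hm : Measurable fun x => if p x then f x else g x :=
    Measurable.ite hp hf.measurable hg.measurable
  refine ⟨hm, Measure.ext fun s hs => ?_⟩
  rw [Measure.map_apply hm hs, ← measure_inter_add_sdiff s hB, ← measure_inter_add_sdiff _ hp,
    ← hf.measure_preimage (hs.inter hB).nullMeasurableSet,
    ← hg.measure_preimage (hs.diff hB).nullMeasurableSet]
  congr 2
  · ext x
    by_cases h : p x <;> simp [h, hfB]
  · ext x
    by_cases h : p x <;> simp [h, hgB]

/-- The choice whether to rotate depends only on the sign of S_{n+1}, which the rotation itself
leaves unchanged. -/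
lemma measurePreserving_negFirst (n : ℕ) : MeasurePreserving (negFirst n) (iid μ) (iid μ) := by
  induction n with
  | zero => exact MeasurePreserving.id _
  | succ n ih =>
    have : MeasurePreserving
        (fun y : ℕ → ℝ => if psum y (n + 1) < 0 then rotate n y else y) (iid μ) (iid μ) :=
      (measurePreserving_rotate μ n).ite (MeasurePreserving.id _) (B := {y | psum y (n + 1) < 0})
        (measurableSet_lt (by fun_prop) measurable_const)
        (fun x => by simp [psum_rotate]) (fun x => by simp)
    exact this.comp ih

lemma measurableSet_isFirstMin (n k : ℕ) : MeasurableSet {x | IsFirstMin n k x} := by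
  have : {x | IsFirstMin n k x} = {_x : ℕ → ℝ | k ≤ n} ∩
      ((⋂ i, ⋂ (_ : i < k), {x | psum x k < psum x i}) ∩
        ⋂ i, ⋂ (_ : k ≤ i), ⋂ (_ : i ≤ n), {x | psum x k ≤ psum x i}) := by
    ext x; simp [IsFirstMin]
  rw [this]
  refine (MeasurableSet.const _).inter ((MeasurableSet.iInter fun i => MeasurableSet.iInter fun _ =>
    measurableSet_lt (by fun_prop) (by fun_prop)).inter (MeasurableSet.iInter fun i =>
    MeasurableSet.iInter fun _ => MeasurableSet.iInter fun _ =>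
      measurableSet_le (by fun_prop) (by fun_prop)))

@[fun_prop]
lemma measurable_negCount (n : ℕ) : Measurable (negCount n) := by
  unfold negCount
  exact Finset.measurable_sum _ fun k _ =>
    Measurable.ite (measurableSet_lt (by fun_prop) measurable_const) measurable_const
      measurable_const

lemma measure_negCount_eq (n k : ℕ) :
    iid μ {x | negCount n x = k} = iid μ {x | IsFirstMin n k x} := by
  rw [← (measurePreserving_negFirst μ n).measure_preimage
    (measurableSet_isFirstMin n k).nullMeasurableSet]
  congr 1
  ext x
  exact (isFirstMin_negFirst_iff n k x).symm

/-- The probability that `k` is a strict descending ladder index. -/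
def ladderProb (k : ℕ) : ℝ := (iid μ).real {x | IsFirstMin k k x}

/-- The probability that the walk is nonnegative up to time `m`. -/
def stayProb (m : ℕ) : ℝ := (iid μ).real {x | ∀ i ≤ m, 0 ≤ psum x i}

/-- The probability that the walk is negative at time `n`. -/
def negProb (n : ℕ) : ℝ := (iid μ).real {x | psum x n < 0}

lemma measurableSet_stay (m : ℕ) : MeasurableSet {x : ℕ → ℝ | ∀ i ≤ m, 0 ≤ psum x i} := by
  have : {x : ℕ → ℝ | ∀ i ≤ m, 0 ≤ psum x i} = ⋂ i, ⋂ (_ : i ≤ m), {x | 0 ≤ psum x i} := by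
    ext; simp
  rw [this]
  exact MeasurableSet.iInter fun i => MeasurableSet.iInter fun _ =>
    measurableSet_le measurable_const (by fun_prop)

lemma measureReal_isFirstMin_add (k m : ℕ) :
    (iid μ).real {x | IsFirstMin (k + m) k x} = ladderProb μ k * stayProb μ m := by
  have hind := indep_iSup_of_disjoint
    (m := fun i : ℕ => MeasurableSpace.comap (fun x : ℕ → ℝ => x i) inferInstance)
    (fun i => (measurable_pi_apply i).comap_le) (iIndepFun_iid μ)
    (S := Iio k) (T := Ici k) (by
      rw [Set.disjoint_left]; intro i hi hi'; exact absurd (mem_Iio.1 hi) (not_lt.2 hi'))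
  have hmeas : ∀ (S : Set ℕ) (i : ℕ), i ∈ S → Measurable[⨆ i ∈ S,
      MeasurableSpace.comap (fun x : ℕ → ℝ => x i) inferInstance] (fun x : ℕ → ℝ => x i) :=
    fun S i hi => (comap_measurable _).mono (le_iSup₂_of_le i hi le_rfl) le_rfl
  have hps : ∀ i ≤ k, Measurable[⨆ i ∈ Iio k,
      MeasurableSpace.comap (fun x : ℕ → ℝ => x i) inferInstance] (fun x : ℕ → ℝ => psum x i) := by
    intro i hi
    exact Finset.measurable_sum _ fun j hj => hmeas _ j
      (lt_of_lt_of_le (Finset.mem_range.1 hj) hi)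
  have hA : MeasurableSet[⨆ i ∈ Iio k,
      MeasurableSpace.comap (fun x : ℕ → ℝ => x i) inferInstance] {x | IsFirstMin k k x} := by
    have : {x : ℕ → ℝ | IsFirstMin k k x} = ⋂ i, ⋂ (_ : i < k), {x | psum x k < psum x i} := by
      ext x
      simp only [mem_ofPred_eq, mem_iInter]
      exact ⟨fun h => h.2.1, fun h => ⟨le_rfl, h, fun i hi hi' => by rw [le_antisymm hi hi']⟩⟩
    rw [this]
    exact MeasurableSet.iInter fun i => MeasurableSet.iInter fun hi =>
      measurableSet_lt (hps k le_rfl) (hps i hi.le)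
  have hB : MeasurableSet[⨆ i ∈ Ici k,
      MeasurableSpace.comap (fun x : ℕ → ℝ => x i) inferInstance]
      {x | ∀ i ≤ m, 0 ≤ psum (fun j => x (k + j)) i} := by
    have : {x : ℕ → ℝ | ∀ i ≤ m, 0 ≤ psum (fun j => x (k + j)) i} =
      ⋂ i, ⋂ (_ : i ≤ m), {x | 0 ≤ psum (fun j => x (k + j)) i} := by ext; simp
    rw [this]
    exact MeasurableSet.iInter fun i => MeasurableSet.iInter fun hi =>
      measurableSet_le measurable_const
        (Finset.measurable_sum _ fun j hj => hmeas _ (k + j) (by simp))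
  have := (Indep_iff _ _ _).1 hind _ _ hA hB
  have hshift := (measurePreserving_reindex μ (g := fun j => k + j)
    (fun i j h => by simpa using h)).measure_preimage (measurableSet_stay m).nullMeasurableSet
  unfold ladderProb stayProb
  rw [Measure.real, Measure.real, Measure.real, ← ENNReal.toReal_mul, ← hshift]
  change _ = (_ * iid μ {x | ∀ i ≤ m, 0 ≤ psum (fun j => x (k + j)) i}).toReal
  rw [← this]
  congr 2
  ext x
  exact isFirstMin_add_iff k m x

lemma measureReal_negCount_eq {n k : ℕ} (h : k ≤ n) :
    (iid μ).real {x | negCount n x = k} = ladderProb μ k * stayProb μ (n - k) := by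
  obtain ⟨m, rfl⟩ := Nat.exists_eq_add_of_le h
  rw [Measure.real, measure_negCount_eq, Nat.add_sub_cancel_left, ← measureReal_isFirstMin_add]
  rfl

lemma negCount_le (n : ℕ) (x : ℕ → ℝ) : negCount n x ≤ n := (isFirstMin_negFirst n x).1

/-- The integral of a function of the number of negative partial sums. -/
lemma integral_negCount {E : Type*} [NormedAddCommGroup E] [NormedSpace ℝ E] [CompleteSpace E]
    (n : ℕ) (f : ℕ → E) :
    ∫ x, f (negCount n x) ∂(iid μ) =
      ∑ k ∈ Finset.range (n + 1), (ladderProb μ k * stayProb μ (n - k)) • f k := by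
  have h : ∀ x, f (negCount n x) =
      ∑ k ∈ Finset.range (n + 1), {x | negCount n x = k}.indicator (fun _ => f k) x := by
    intro x
    rw [Finset.sum_eq_single (negCount n x)]
    · simp
    · intro b _ hb
      simp [hb.symm]
    · intro hx
      exact absurd (Finset.mem_range.2 (Nat.lt_succ_of_le (negCount_le n x))) hx
  have hm : ∀ k, MeasurableSet {x | negCount n x = k} := fun k =>
    measurable_negCount n (measurableSet_singleton k)
  simp_rw [h]
  rw [integral_finsetSum _ fun k _ => (integrable_const _).indicator (hm k)]
  refine Finset.sum_congr rfl fun k hk => ?_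
  rw [integral_indicator_const _ (hm k),
    measureReal_negCount_eq μ (Nat.lt_succ_iff.1 (Finset.mem_range.1 hk))]

lemma sum_ladderProb_mul_stayProb (n : ℕ) :
    ∑ k ∈ Finset.range (n + 1), ladderProb μ k * stayProb μ (n - k) = 1 := by
  have := integral_negCount μ n (fun _ => (1 : ℝ))
  simpa using this.symm

/-- Both sides compute the mean of the number of negative partial sums: by its law, and by linearity
of expectation. -/
lemma sum_mul_ladderProb_mul_stayProb (n : ℕ) :
    ∑ k ∈ Finset.range (n + 1), k * (ladderProb μ k * stayProb μ (n - k)) =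
      ∑ k ∈ Finset.range n, negProb μ (k + 1) := by
  have := integral_negCount μ n (fun k => (k : ℝ))
  simp only [smul_eq_mul] at this
  simp_rw [mul_comm (_ : ℝ) (ladderProb μ _ * _)]
  rw [← this]
  have hm : ∀ k, MeasurableSet {x : ℕ → ℝ | psum x k < 0} := fun k =>
    measurableSet_lt (by fun_prop) measurable_const
  have h : ∀ x, (negCount n x : ℝ) =
      ∑ k ∈ Finset.range n, {x | psum x (k + 1) < 0}.indicator (fun _ => (1 : ℝ)) x := by
    intro x
    simp [negCount, Set.indicator_apply]
  simp_rw [h]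
  rw [integral_finsetSum _ fun k _ => (integrable_const _).indicator (hm _)]
  refine Finset.sum_congr rfl fun k _ => ?_
  rw [integral_indicator_const _ (hm _)]
  simp [negProb]

end

/-! ### Power series -/

/-- In formal power series the hypotheses say U V (1-X) = 1 and (X U') V (1-X) = ∑ p_n Xⁿ over n ≥
1. Multiplying the second by U eliminates V and leaves X U' = U ∑ p_n Xⁿ. -/
lemma coeff_recursion_of_convolution {u v p : ℕ → ℝ}
    (h1 : ∀ n, ∑ k ∈ Finset.range (n + 1), u k * v (n - k) = 1)
    (h2 : ∀ n, ∑ k ∈ Finset.range (n + 1), k * (u k * v (n - k)) =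
      ∑ k ∈ Finset.range n, p (k + 1)) (n : ℕ) :
    (n + 1 : ℝ) * u (n + 1) = ∑ k ∈ Finset.range (n + 1), p (k + 1) * u (n - k) := by
  open PowerSeries in
  have hUV : (mk u * mk v) * (1 - X) = (1 : PowerSeries ℝ) := by
    have : mk u * mk v = (mk 1 : PowerSeries ℝ) := by
      ext n
      rw [coeff_mul, Finset.Nat.sum_antidiagonal_eq_sum_range_succ_mk]
      simpa using h1 n
    rw [this, mk_one_mul_one_sub_eq_one]
  open PowerSeries in
  have hDV : (mk (fun n => n * u n) * mk v) * (1 - X) =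
      (X * mk (fun n => p (n + 1)) : PowerSeries ℝ) := by
    have : mk (fun n => n * u n) * mk v =
        (mk (fun n => ∑ k ∈ Finset.range n, p (k + 1)) : PowerSeries ℝ) := by
      ext n
      rw [coeff_mul, Finset.Nat.sum_antidiagonal_eq_sum_range_succ_mk]
      simpa [mul_assoc] using h2 n
    rw [this]
    ext n
    cases n with
    | zero => simp
    | succ n =>
      rw [mul_sub, mul_one, map_sub, coeff_succ_mul_X, coeff_succ_X_mul]
      simp [Finset.sum_range_succ]
  open PowerSeries in
  have hD : mk (fun n => n * u n) = (X * (mk (fun n => p (n + 1)) * mk u) : PowerSeries ℝ) := by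
    calc mk (fun n => n * u n)
        = mk (fun n => n * u n) * ((mk u * mk v) * (1 - X)) := by rw [hUV, mul_one]
      _ = ((mk (fun n => n * u n) * mk v) * (1 - X)) * mk u := by ring
      _ = _ := by rw [hDV]; ring
  have := congrArg (PowerSeries.coeff (n + 1)) hD
  rw [PowerSeries.coeff_succ_X_mul, PowerSeries.coeff_mul,
    Finset.Nat.sum_antidiagonal_eq_sum_range_succ_mk] at this
  simpa using this

lemma summable_norm_mul_pow_of_bounded {a : ℕ → ℝ} {C : ℝ} (ha : ∀ n, |a n| ≤ C) {z : ℂ}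
    (hz : ‖z‖ < 1) : Summable fun n => ‖(a n : ℂ) * z ^ n‖ := by
  refine Summable.of_nonneg_of_le (fun _ => norm_nonneg _) (fun n => ?_)
    ((summable_geometric_of_lt_one (norm_nonneg z) hz).mul_left C)
  rw [norm_mul, norm_pow, Complex.norm_real, Real.norm_eq_abs]
  gcongr
  exact ha n

lemma hasDerivAt_tsum_mul_pow {a : ℕ → ℝ} {C : ℝ} (ha : ∀ n, |a n| ≤ C) {z : ℂ}
    (hz : ‖z‖ < 1) :
    HasDerivAt (fun z : ℂ => ∑' n, (a n : ℂ) * z ^ n)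
      (∑' n : ℕ, (((n + 1 : ℝ) * a (n + 1) : ℝ) : ℂ) * z ^ n) z := by
  -- Termwise differentiation needs a uniform summable bound on the derivatives, available on a disc
  -- of radius strictly below 1.
  obtain ⟨r, hzr, hr⟩ := exists_between hz
  have hr0 : 0 ≤ r := (norm_nonneg z).trans hzr.le
  have hsum : Summable fun n : ℕ => C * (n * r ^ (n - 1)) := by
    refine Summable.mul_left C ?_
    rw [← summable_nat_add_iff 1]
    have h1 := summable_pow_mul_geometric_of_norm_lt_one (R := ℝ) 1
      (r := r) (by rwa [Real.norm_eq_abs, abs_of_nonneg hr0])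
    have h2 := summable_geometric_of_lt_one hr0 hr
    refine (h1.add h2).congr fun n => ?_
    simp only [Nat.add_sub_cancel, Nat.cast_add, Nat.cast_one, pow_one]
    ring
  have key := hasDerivAt_tsum_of_isPreconnected (𝕜 := ℂ) (u := fun n : ℕ => C * (n * r ^ (n - 1)))
    (g := fun (n : ℕ) (y : ℂ) => (a n : ℂ) * y ^ n)
    (g' := fun (n : ℕ) (y : ℂ) => (a n : ℂ) * (n * y ^ (n - 1)))
    (t := Metric.ball 0 r) (y₀ := 0) (y := z) hsum Metric.isOpen_ball
    (convex_ball (0 : ℂ) r).isPreconnected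
    (fun n y _ => (hasDerivAt_pow n y).const_mul _)
    (fun n y hy => by
      rw [norm_mul, norm_mul, norm_pow, Complex.norm_real, Real.norm_eq_abs, Complex.norm_natCast]
      have hy' : ‖y‖ ≤ r := by simpa using (mem_ball_zero_iff.1 hy).le
      have := ha n
      have hC : 0 ≤ C := (abs_nonneg _).trans this
      gcongr)
    (by simpa using (norm_nonneg z).trans_lt hzr)
    (summable_norm_mul_pow_of_bounded ha (by simp)).of_norm
    (by simpa using hzr)
  convert! key using 1
  rw [Summable.tsum_eq_zero_add (f := fun n : ℕ => (a n : ℂ) * (n * z ^ (n - 1)))]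
  · simp only [CharP.cast_eq_zero, zero_mul, mul_zero, zero_add, Nat.add_sub_cancel]
    refine tsum_congr fun n => ?_
    push_cast
    ring
  · refine Summable.of_norm_bounded hsum fun n => ?_
    rw [norm_mul, norm_mul, norm_pow, Complex.norm_real, Real.norm_eq_abs, Complex.norm_natCast]
    have := ha n
    have hC : 0 ≤ C := (abs_nonneg _).trans this
    gcongr

lemma abs_div_natCast_le {p : ℕ → ℝ} (hp : ∀ n, |p n| ≤ 1) (n : ℕ) : |p n / n| ≤ 1 := by
  rcases Nat.eq_zero_or_pos n with rfl | hn
  · simp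
  · rw [abs_div, Nat.abs_cast]
    have : (1 : ℝ) ≤ n := by exact_mod_cast hn
    exact (div_le_one (by linarith)).2 ((hp n).trans this)

/-- The recursion is the equation U' = U L' in coefficients. Hence U exp(-L) is constant on the unit
disc, with value 1 at 0. The term n = 0 of L vanishes because division by 0 gives 0. -/
lemma tsum_eq_exp_of_recursion {u p : ℕ → ℝ} (hu : ∀ n, |u n| ≤ 1) (hp : ∀ n, |p n| ≤ 1)
    (hu0 : u 0 = 1)
    (h : ∀ n : ℕ, (n + 1 : ℝ) * u (n + 1) = ∑ k ∈ Finset.range (n + 1), p (k + 1) * u (n - k))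
    {z : ℂ} (hz : ‖z‖ < 1) :
    ∑' n, (u n : ℂ) * z ^ n = Complex.exp (∑' n, ((p n / n : ℝ) : ℂ) * z ^ n) := by
  set U : ℂ → ℂ := fun z => ∑' n, (u n : ℂ) * z ^ n with hU
  set L : ℂ → ℂ := fun z => ∑' n, ((p n / n : ℝ) : ℂ) * z ^ n with hL
  have hdU : ∀ y : ℂ, ‖y‖ < 1 → HasDerivAt U (U y * ∑' n, (p (n + 1) : ℂ) * y ^ n) y := by
    intro y hy
    convert! hasDerivAt_tsum_mul_pow hu hy using 1
    rw [mul_comm, hU]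
    rw [tsum_mul_tsum_eq_tsum_sum_antidiagonal_of_summable_norm
      (summable_norm_mul_pow_of_bounded (fun n => hp (n + 1)) hy)
      (summable_norm_mul_pow_of_bounded hu hy)]
    refine tsum_congr fun n => ?_
    rw [Finset.Nat.sum_antidiagonal_eq_sum_range_succ_mk, h n]
    push_cast
    rw [Finset.sum_mul]
    refine Finset.sum_congr rfl fun k hk => ?_
    rw [← Nat.add_sub_of_le (Nat.lt_succ_iff.1 (Finset.mem_range.1 hk)), Nat.add_sub_cancel_left]
    ring
  have hdL : ∀ y : ℂ, ‖y‖ < 1 → HasDerivAt L (∑' n, (p (n + 1) : ℂ) * y ^ n) y := by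
    intro y hy
    convert! hasDerivAt_tsum_mul_pow (abs_div_natCast_le hp) hy using 1
    refine tsum_congr fun n => ?_
    congr 2
    push_cast
    field_simp
  have hd : ∀ y ∈ Metric.ball (0 : ℂ) 1,
      HasDerivAt (fun y => U y * Complex.exp (-L y)) 0 y := by
    intro y hy
    have hy' : ‖y‖ < 1 := by simpa using hy
    convert! (hdU y hy').mul (hdL y hy').neg.cexp using 1
    ring
  have hconst := Metric.isOpen_ball.is_const_of_deriv_eq_zero
    (convex_ball (0 : ℂ) 1).isPreconnected
    (fun y hy => (hd y hy).differentiableAt.differentiableWithinAt)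
    (fun y hy => (hd y hy).deriv) (x := z) (y := 0) (by simpa using hz) (by simp)
  have hU0 : U 0 = 1 := by
    rw [hU]
    simp only
    rw [tsum_eq_single 0 (fun n hn => by simp [hn])]
    simp [hu0]
  have hL0 : L 0 = 0 := by
    rw [hL]
    simp only
    rw [tsum_eq_single 0 (fun n hn => by simp [hn])]
    simp
  simp only [hU0, hL0, neg_zero, Complex.exp_zero, mul_one] at hconst
  rw [Complex.exp_neg] at hconst
  exact (mul_inv_eq_one₀ (Complex.exp_ne_zero _)).1 hconst

lemma tendsto_tsum_mul_ofReal_pow {a : ℕ → ℝ} (ha : Summable fun n => |a n|) {w : ℂ}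
    (hw : ‖w‖ ≤ 1) :
    Tendsto (fun r : ℝ => ∑' n, (a n : ℂ) * ((r : ℂ) * w) ^ n) (𝓝[<] 1)
      (𝓝 (∑' n, (a n : ℂ) * w ^ n)) := by
  refine tendsto_tsum_of_dominated_convergence ha (fun n => ?_) ?_
  · refine Tendsto.mono_left ?_ nhdsWithin_le_nhds
    have : Continuous fun r : ℝ => (a n : ℂ) * ((r : ℂ) * w) ^ n := by fun_prop
    simpa using this.tendsto 1
  · filter_upwards [Ioo_mem_nhdsLT (show (0 : ℝ) < 1 by norm_num)] with r hr n
    rw [norm_mul, norm_pow, norm_mul, Complex.norm_real, Complex.norm_real, Real.norm_eq_abs,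
      Real.norm_eq_abs, abs_of_pos hr.1]
    refine mul_le_of_le_one_right (abs_nonneg _) (pow_le_one₀ (by have := hr.1; positivity) ?_)
    exact mul_le_one₀ hr.2.le (norm_nonneg _) hw

/-! ### Sparre Andersen identities for ladder indices and the descending epoch -/

section

variable (μ : Measure ℝ)

lemma negProb_nonneg (n : ℕ) : 0 ≤ negProb μ n := measureReal_nonneg

lemma ladderProb_nonneg (n : ℕ) : 0 ≤ ladderProb μ n := measureReal_nonneg

lemma lt_descendingEpoch_iff (x : ℕ → ℝ) (m : ℕ) :
    (m : ℕ∞) < descendingEpoch (fun i (x : ℕ → ℝ) => x i) x ↔ ∀ i ≤ m, 0 ≤ psum x i := by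
  rw [← ENat.add_one_le_iff (ENat.natCast_ne_top m), descendingEpoch, le_sInf_iff]
  constructor
  · intro h i hi
    by_contra hneg
    push Not at hneg
    have hi1 : 1 ≤ i := by
      rcases Nat.eq_zero_or_pos i with rfl | h
      · simp at hneg
      · exact h
    have := h i ⟨i, rfl, hi1, hneg⟩
    have : m + 1 ≤ i := by exact_mod_cast this
    omega
  · rintro h _ ⟨n, rfl, _, hn⟩
    by_contra hlt
    have : ¬ (m + 1 ≤ n) := fun h' => hlt (by exact_mod_cast h')
    exact absurd (h n (by omega)) (not_le.2 hn)

/-- The probability that the descending ladder epoch equals `n`. -/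
def epochProb (n : ℕ) : ℝ := (iid μ).real {x | descendingEpoch (fun i (x : ℕ → ℝ) => x i) x = n}

lemma setOf_descendingEpoch_eq_zero :
    {x : ℕ → ℝ | descendingEpoch (fun i (x : ℕ → ℝ) => x i) x = (0 : ℕ)} = ∅ := by
  ext x
  have := (lt_descendingEpoch_iff x 0).2 (fun i hi => by simp [Nat.le_zero.1 hi])
  simpa using this.ne'

lemma epochProb_zero : epochProb μ 0 = 0 := by
  rw [epochProb, setOf_descendingEpoch_eq_zero, measureReal_empty]

lemma summable_negProb_div (h : Summable (negProb μ)) : Summable fun n => negProb μ n / n := by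
  refine Summable.of_nonneg_of_le (fun n => div_nonneg (negProb_nonneg μ n) (by positivity))
    (fun n => ?_) h
  rcases Nat.eq_zero_or_pos n with rfl | hn
  · simpa using negProb_nonneg μ 0
  · exact div_le_self (negProb_nonneg μ n) (by exact_mod_cast hn)

variable [IsProbabilityMeasure μ]

lemma abs_ladderProb_le (n : ℕ) : |ladderProb μ n| ≤ 1 := by
  rw [ladderProb, abs_of_nonneg measureReal_nonneg]; exact measureReal_le_one

lemma abs_stayProb_le (n : ℕ) : |stayProb μ n| ≤ 1 := by
  rw [stayProb, abs_of_nonneg measureReal_nonneg]; exact measureReal_le_one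

lemma abs_negProb_le (n : ℕ) : |negProb μ n| ≤ 1 := by
  rw [negProb, abs_of_nonneg measureReal_nonneg]; exact measureReal_le_one

lemma ladderProb_zero : ladderProb μ 0 = 1 := by
  have : {x : ℕ → ℝ | IsFirstMin 0 0 x} = univ := by
    ext x
    simp only [mem_ofPred_eq, mem_univ, iff_true]
    exact ⟨le_rfl, by simp, fun i _ hi => by simp [Nat.le_zero.1 hi]⟩
  simp [ladderProb, this]

lemma stayProb_zero : stayProb μ 0 = 1 := by
  simp [stayProb]

/-- The exponent `∑ P(S_n < 0) zⁿ / n`. -/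
def spitzerSeries (z : ℂ) : ℂ := ∑' n, ((negProb μ n / n : ℝ) : ℂ) * z ^ n

/-- The Sparre Andersen formula for the generating function of the ladder indices. -/
lemma tsum_ladderProb {z : ℂ} (hz : ‖z‖ < 1) :
    ∑' n, (ladderProb μ n : ℂ) * z ^ n = Complex.exp (spitzerSeries μ z) :=
  tsum_eq_exp_of_recursion (abs_ladderProb_le μ) (abs_negProb_le μ) (ladderProb_zero μ)
    (coeff_recursion_of_convolution (sum_ladderProb_mul_stayProb μ)
      (sum_mul_ladderProb_mul_stayProb μ)) hz

/-- The convolution identity reads U V = 1/(1-z), and U = exp L. -/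
lemma tsum_stayProb {z : ℂ} (hz : ‖z‖ < 1) :
    (1 - z) * ∑' n, (stayProb μ n : ℂ) * z ^ n = Complex.exp (-spitzerSeries μ z) := by
  have h := tsum_mul_tsum_eq_tsum_sum_antidiagonal_of_summable_norm
    (summable_norm_mul_pow_of_bounded (abs_ladderProb_le μ) hz)
    (summable_norm_mul_pow_of_bounded (abs_stayProb_le μ) hz)
  have h1 : ∀ n, ∑ kl ∈ Finset.HasAntidiagonal.antidiagonal n,
      (ladderProb μ kl.1 : ℂ) * z ^ kl.1 * ((stayProb μ kl.2 : ℂ) * z ^ kl.2) = z ^ n := by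
    intro n
    rw [Finset.Nat.sum_antidiagonal_eq_sum_range_succ_mk]
    have := congrArg (fun t : ℝ => (t : ℂ) * z ^ n) (sum_ladderProb_mul_stayProb μ n)
    simp only [Complex.ofReal_one, one_mul] at this
    rw [← this]
    push_cast
    rw [Finset.sum_mul]
    refine Finset.sum_congr rfl fun k hk => ?_
    have : z ^ n = z ^ k * z ^ (n - k) := by
      rw [← pow_add, Nat.add_sub_of_le (Nat.lt_succ_iff.1 (Finset.mem_range.1 hk))]
    rw [this]
    ring
  simp_rw [h1] at h
  rw [tsum_geometric_of_norm_lt_one hz, tsum_ladderProb μ hz] at h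
  have hz1 : 1 - z ≠ 0 := by
    intro h0
    have : z = 1 := by linear_combination -h0
    simp [this] at hz
  rw [Complex.exp_neg]
  refine eq_inv_of_mul_eq_one_left ?_
  rw [mul_assoc, mul_comm _ (Complex.exp _), h, mul_inv_cancel₀ hz1]

lemma measurableSet_lt_descendingEpoch (m : ℕ) :
    MeasurableSet {x | (m : ℕ∞) < descendingEpoch (fun i (x : ℕ → ℝ) => x i) x} := by
  simp_rw [lt_descendingEpoch_iff]
  exact measurableSet_stay m

lemma setOf_descendingEpoch_eq_succ (n : ℕ) :
    {x | descendingEpoch (fun i (x : ℕ → ℝ) => x i) x = (n + 1 : ℕ)} =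
      {x | (n : ℕ∞) < descendingEpoch (fun i (x : ℕ → ℝ) => x i) x} \
        {x | ((n + 1 : ℕ) : ℕ∞) < descendingEpoch (fun i (x : ℕ → ℝ) => x i) x} := by
  ext x
  simp only [mem_ofPred_eq, Set.mem_sdiff, not_lt]
  rw [← ENat.add_one_le_iff (ENat.natCast_ne_top n), le_antisymm_iff, and_comm]
  norm_cast

lemma epochProb_succ (n : ℕ) : epochProb μ (n + 1) = stayProb μ n - stayProb μ (n + 1) := by
  rw [epochProb, setOf_descendingEpoch_eq_succ, measureReal_sdiff ?_
    (measurableSet_lt_descendingEpoch _)]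
  · simp_rw [lt_descendingEpoch_iff]
    rfl
  · intro x hx
    exact lt_trans (b := ((n + 1 : ℕ) : ℕ∞)) (by exact_mod_cast n.lt_succ_self) hx

lemma measurableSet_descendingEpoch_eq (n : ℕ) :
    MeasurableSet {x | descendingEpoch (fun i (x : ℕ → ℝ) => x i) x = n} := by
  cases n with
  | zero =>
    rw [setOf_descendingEpoch_eq_zero]
    exact MeasurableSet.empty
  | succ n =>
    rw [setOf_descendingEpoch_eq_succ]
    exact (measurableSet_lt_descendingEpoch _).diff (measurableSet_lt_descendingEpoch _)

/-- The Sparre Andersen formula for the generating function of the first descending ladder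
epoch. -/
lemma tsum_epochProb {z : ℂ} (hz : ‖z‖ < 1) :
    ∑' n, (epochProb μ n : ℂ) * z ^ n = 1 - Complex.exp (-spitzerSeries μ z) := by
  have hs := (summable_norm_mul_pow_of_bounded (abs_stayProb_le μ) hz).of_norm
  have hs1 := (summable_nat_add_iff 1).2 hs
  have he : Summable fun n => (epochProb μ n : ℂ) * z ^ n :=
    (summable_norm_mul_pow_of_bounded (C := 1) (fun n => by
      rw [epochProb, abs_of_nonneg measureReal_nonneg]; exact measureReal_le_one) hz).of_norm
  have h0 := hs.tsum_eq_zero_add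
  rw [← tsum_stayProb μ hz, he.tsum_eq_zero_add]
  -- P(R = n+1) = v_n - v_{n+1}, so summation gives zV - (V - 1) = 1 - (1-z)V.
  have : ∀ n, (epochProb μ (n + 1) : ℂ) * z ^ (n + 1) =
      z * ((stayProb μ n : ℂ) * z ^ n) - (stayProb μ (n + 1) : ℂ) * z ^ (n + 1) := by
    intro n
    rw [epochProb_succ]
    push_cast
    ring
  simp_rw [this]
  rw [(hs.mul_left z).tsum_sub hs1, tsum_mul_left, epochProb_zero]
  rw [stayProb_zero] at h0
  simp only [Complex.ofReal_zero, zero_add, pow_zero, Complex.ofReal_one, mul_one] at h0 ⊢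
  linear_combination h0

/-! ### Occupation time -/

/-- For 0 < r < 1 the nonnegative series U(r) = exp L(r) is at most exp L(1). Letting r increase to
1 bounds every partial sum. -/
lemma summable_ladderProb (h : Summable fun n => negProb μ n / n) : Summable (ladderProb μ) := by
  have hq : ∀ n : ℕ, 0 ≤ negProb μ n / n := fun n =>
    div_nonneg (negProb_nonneg μ n) (by positivity)
  refine summable_of_sum_range_le (c := Real.exp (∑' n, negProb μ n / n)) (ladderProb_nonneg μ)
    fun N => ?_
  have hb : ∀ r ∈ Ioo (0 : ℝ) 1, ∑ k ∈ Finset.range N, ladderProb μ k * r ^ k ≤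
      Real.exp (∑' n, negProb μ n / n) := by
    intro r hr
    have hr' : ‖(r : ℂ)‖ < 1 := by
      rw [Complex.norm_real, Real.norm_eq_abs, abs_of_pos hr.1]; exact hr.2
    have h1 := tsum_ladderProb μ hr'
    have h2 : ∑' n, ladderProb μ n * r ^ n = Real.exp (∑' n, negProb μ n / n * r ^ n) := by
      have : ((∑' n, ladderProb μ n * r ^ n : ℝ) : ℂ) =
          (Real.exp (∑' n, negProb μ n / n * r ^ n) : ℝ) := by
        push_cast
        rw [h1, spitzerSeries]
        push_cast
        rfl
      exact_mod_cast this
    have hs : Summable fun n => ladderProb μ n * r ^ n := by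
      refine (summable_norm_mul_pow_of_bounded (abs_ladderProb_le μ) hr').congr fun n => ?_
      rw [norm_mul, norm_pow, Complex.norm_real, Complex.norm_real, Real.norm_eq_abs,
        Real.norm_eq_abs, abs_of_pos hr.1, abs_of_nonneg (ladderProb_nonneg μ n)]
    refine (hs.sum_le_tsum _ fun n _ => mul_nonneg (ladderProb_nonneg μ n)
      (pow_nonneg hr.1.le _)).trans ?_
    rw [h2]
    have hle : ∀ n : ℕ, negProb μ n / n * r ^ n ≤ negProb μ n / n := fun n =>
      mul_le_of_le_one_right (hq n) (pow_le_one₀ hr.1.le hr.2.le)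
    exact Real.exp_le_exp.2 ((Summable.of_nonneg_of_le (fun n =>
      mul_nonneg (hq n) (pow_nonneg hr.1.le _)) hle h).tsum_le_tsum hle h)
  have hc : Continuous fun r : ℝ => ∑ k ∈ Finset.range N, ladderProb μ k * r ^ k := by fun_prop
  have ht : Tendsto (fun r : ℝ => ∑ k ∈ Finset.range N, ladderProb μ k * r ^ k) (𝓝[<] 1)
      (𝓝 (∑ k ∈ Finset.range N, ladderProb μ k)) := by
    simpa using (hc.tendsto 1).mono_left (nhdsWithin_le_nhds (s := Iio 1))
  refine le_of_tendsto ht ?_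
  filter_upwards [Ioo_mem_nhdsLT (show (0 : ℝ) < 1 by norm_num)] with r hr using hb r hr

/-- Radial limit of U = exp L; both series converge absolutely on the closed disc. The unit circle
is where characteristic functions live. -/
lemma tsum_ladderProb_of_norm_le_one (h : Summable fun n => negProb μ n / n) {w : ℂ}
    (hw : ‖w‖ ≤ 1) :
    ∑' n, (ladderProb μ n : ℂ) * w ^ n = Complex.exp (spitzerSeries μ w) := by
  have h1 := tendsto_tsum_mul_ofReal_pow (summable_ladderProb μ h).abs hw
  have h2 := ((Complex.continuous_exp.tendsto _).comp (tendsto_tsum_mul_ofReal_pow h.abs hw))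
  refine tendsto_nhds_unique_of_eventuallyEq h1 h2 ?_
  filter_upwards [Ioo_mem_nhdsLT (show (0 : ℝ) < 1 by norm_num)] with r hr
  refine tsum_ladderProb μ ?_
  rw [norm_mul, Complex.norm_real, Real.norm_eq_abs, abs_of_pos hr.1]
  exact (mul_le_of_le_one_right hr.1.le hw).trans_lt hr.2

lemma stayProb_antitone : Antitone (stayProb μ) := by
  intro m n hmn
  exact measureReal_mono fun x hx i hi => hx i (hi.trans hmn)

/-- In ∑ u_k v_{n-k} w^k the factor v_{n-k} decreases to its infimum for each fixed k, and the terms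
are dominated by the summable u_k. -/
lemma tendsto_integral_pow_negCount (h : Summable fun n => negProb μ n / n) {w : ℂ}
    (hw : ‖w‖ ≤ 1) :
    Tendsto (fun n => ∫ x, w ^ negCount n x ∂(iid μ)) atTop
      (𝓝 (((⨅ n, stayProb μ n : ℝ) : ℂ) * Complex.exp (spitzerSeries μ w))) := by
  have hstay : Tendsto (stayProb μ) atTop (𝓝 (⨅ n, stayProb μ n)) :=
    tendsto_atTop_ciInf (stayProb_antitone μ) ⟨0, by rintro _ ⟨n, rfl⟩; exact measureReal_nonneg⟩
  have heq : ∀ n, ∫ x, w ^ negCount n x ∂(iid μ) =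
      ∑' k, if k ≤ n then (ladderProb μ k : ℂ) * (stayProb μ (n - k) : ℂ) * w ^ k else 0 := by
    intro n
    rw [integral_negCount μ n (fun k => w ^ k), tsum_eq_sum (s := Finset.range (n + 1))]
    · refine Finset.sum_congr rfl fun k hk => ?_
      rw [if_pos (Nat.lt_succ_iff.1 (Finset.mem_range.1 hk)), Complex.real_smul]
      push_cast
      ring
    · intro k hk
      rw [if_neg]
      simpa using hk
  simp_rw [heq]
  rw [← tsum_ladderProb_of_norm_le_one μ h hw, ← tsum_mul_left]
  refine tendsto_tsum_of_dominated_convergence (summable_ladderProb μ h) (fun k => ?_) ?_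
  · have h1 : Tendsto (fun n => stayProb μ (n - k)) atTop (𝓝 (⨅ n, stayProb μ n)) :=
      hstay.comp (tendsto_sub_atTop_nat k)
    have h2 : Tendsto (fun n => (ladderProb μ k : ℂ) * (stayProb μ (n - k) : ℂ) * w ^ k) atTop
        (𝓝 ((ladderProb μ k : ℂ) * ((⨅ n, stayProb μ n : ℝ) : ℂ) * w ^ k)) :=
      (((Complex.continuous_ofReal.tendsto _).comp h1).const_mul _).mul_const _
    rw [show ((⨅ n, stayProb μ n : ℝ) : ℂ) * ((ladderProb μ k : ℂ) * w ^ k) =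
      (ladderProb μ k : ℂ) * ((⨅ n, stayProb μ n : ℝ) : ℂ) * w ^ k by ring]
    refine h2.congr' ?_
    filter_upwards [eventually_ge_atTop k] with n hn
    rw [if_pos hn]
  · refine Eventually.of_forall fun n k => ?_
    split_ifs
    · rw [norm_mul, norm_mul, norm_pow, Complex.norm_real, Complex.norm_real, Real.norm_eq_abs,
        Real.norm_eq_abs, abs_of_nonneg (ladderProb_nonneg μ k)]
      calc _ ≤ ladderProb μ k * 1 * 1 := by
            have := ladderProb_nonneg μ k
            gcongr
            · exact abs_stayProb_le μ _
            · exact pow_le_one₀ (norm_nonneg _) hw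
        _ = _ := by ring
    · simpa using ladderProb_nonneg μ k

/-- The occupation time of the negative half-line as a function of the path. -/
def pathOcc (x : ℕ → ℝ) : ℝ≥0∞ := occupationTime (fun i (x : ℕ → ℝ) => x i) x

lemma measurable_pathOcc : Measurable pathOcc := by
  unfold pathOcc occupationTime
  refine Measurable.tsum fun n => ?_
  exact (measurable_const.indicator measurableSet_Iio).comp (measurable_psum (n + 1))

/-- The expected occupation time is ∑ P(S_n < 0), which is finite. -/
lemma pathOcc_lt_top (h : Summable (negProb μ)) : ∀ᵐ x ∂(iid μ), pathOcc x < ∞ := by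
  refine ae_lt_top measurable_pathOcc ?_
  have hm : ∀ k, MeasurableSet {x : ℕ → ℝ | psum x k < 0} := fun k =>
    measurableSet_lt (by fun_prop) measurable_const
  have : ∀ x, pathOcc x = ∑' n : ℕ, {x | psum x (n + 1) < 0}.indicator (fun _ => 1) x := fun x => rfl
  simp_rw [this]
  rw [lintegral_tsum fun n => (measurable_const.indicator (hm _)).aemeasurable]
  have : ∀ n : ℕ, ∫⁻ x, {x | psum x (n + 1) < 0}.indicator (fun _ => 1) x ∂(iid μ) =
      ENNReal.ofReal (negProb μ (n + 1)) := by
    intro n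
    rw [lintegral_indicator_const (hm _), one_mul, negProb, ofReal_measureReal]
  simp_rw [this]
  exact ((summable_nat_add_iff 1).2 h).tsum_ofReal_ne_top

lemma tendsto_negCount {x : ℕ → ℝ} (hx : pathOcc x < ∞) :
    Tendsto (fun n => (negCount n x : ℝ)) atTop (𝓝 (pathOcc x).toReal) := by
  have h1 : Tendsto (fun n => ∑ k ∈ Finset.range n,
      (Iio (0 : ℝ)).indicator (fun _ => (1 : ℝ≥0∞)) (psum x (k + 1))) atTop (𝓝 (pathOcc x)) :=
    ENNReal.tendsto_nat_tsum _
  have h2 := (ENNReal.tendsto_toReal hx.ne).comp h1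
  refine h2.congr fun n => ?_
  simp only [Function.comp_apply, negCount]
  have : (∑ k ∈ Finset.range n, (Iio (0 : ℝ)).indicator (fun _ => (1 : ℝ≥0∞)) (psum x (k + 1))) =
      ((∑ k ∈ Finset.range n, if psum x (k + 1) < 0 then 1 else 0 : ℕ) : ℝ≥0∞) := by
    push_cast
    exact Finset.sum_congr rfl fun k _ => by simp [Set.indicator_apply]
  rw [this, ENNReal.toReal_natCast]

/-- The characteristic function of the occupation time. -/
lemma integral_exp_pathOcc (h : Summable (negProb μ)) (θ : ℝ) :
    ∫ x, Complex.exp (((pathOcc x).toReal : ℂ) * (θ * Complex.I)) ∂(iid μ) =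
      Complex.exp (spitzerSeries μ (Complex.exp (θ * Complex.I)) - spitzerSeries μ 1) := by
  have hs := summable_negProb_div μ h
  have key : ∀ t : ℝ, ∫ x, Complex.exp (((pathOcc x).toReal : ℂ) * (t * Complex.I)) ∂(iid μ) =
      ((⨅ n, stayProb μ n : ℝ) : ℂ) *
        Complex.exp (spitzerSeries μ (Complex.exp (t * Complex.I))) := by
    intro t
    have hnorm : ∀ a : ℝ, ‖Complex.exp (a * (t * Complex.I))‖ = 1 := by
      intro a
      rw [← mul_assoc, ← Complex.ofReal_mul, Complex.norm_exp_ofReal_mul_I]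
    have h1 := tendsto_integral_pow_negCount μ hs (Complex.norm_exp_ofReal_mul_I t).le
    have h2 : Tendsto (fun n => ∫ x, Complex.exp (t * Complex.I) ^ negCount n x ∂(iid μ)) atTop
        (𝓝 (∫ x, Complex.exp (((pathOcc x).toReal : ℂ) * (t * Complex.I)) ∂(iid μ))) := by
      refine tendsto_integral_of_dominated_convergence (fun _ => 1) (fun n => ?_)
        (integrable_const _) (fun n => ?_) ?_
      · exact ((measurable_from_nat (f := fun k => Complex.exp (t * Complex.I) ^ k)).comp
          (measurable_negCount n)).aestronglyMeasurable
      · refine Eventually.of_forall fun x => ?_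
        rw [norm_pow, Complex.norm_exp_ofReal_mul_I, one_pow]
      · filter_upwards [pathOcc_lt_top μ h] with x hx
        have hc : Continuous fun a : ℝ => Complex.exp ((a : ℂ) * (t * Complex.I)) := by fun_prop
        refine ((hc.tendsto _).comp (tendsto_negCount hx)).congr fun n => ?_
        simp only [Function.comp_apply]
        rw [← Complex.exp_nat_mul]
        norm_cast
    exact tendsto_nhds_unique h2 h1
  -- At frequency 0 the left side is 1. This identifies the unknown constant inf v_n as exp(-L(1)).
  have h0 := key 0
  simp only [Complex.ofReal_zero, zero_mul, mul_zero, Complex.exp_zero, integral_const,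
    probReal_univ, one_smul] at h0
  rw [key θ, Complex.exp_sub, eq_div_iff (Complex.exp_ne_zero _)]
  linear_combination (-Complex.exp (spitzerSeries μ (Complex.exp (θ * Complex.I)))) * h0

end

/-! ### The Gaussian tail -/

/-- Half the density of the Gamma distribution with parameter `1/2`. -/
def tailDens (u : ℝ) : ℝ := Real.exp (-u) / (2 * √(Real.pi * u))

/-- The tail `Φ(-√(2t))` of the standard normal distribution. -/
def gaussTail (t : ℝ) : ℝ := cdf (gaussianReal 0 1) (-√(2 * t))

lemma gaussTail_nonneg (t : ℝ) : 0 ≤ gaussTail t := cdf_nonneg _ _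

lemma antitone_gaussTail : Antitone gaussTail := by
  intro s t hst
  refine monotone_cdf _ (neg_le_neg (Real.sqrt_le_sqrt ?_))
  linarith

lemma gaussianReal_real_Iic_neg (a : ℝ) :
    (gaussianReal 0 1).real (Iic (-a)) = (gaussianReal 0 1).real (Ici a) := by
  have h := gaussianReal_map_neg (μ := 0) (v := 1)
  rw [neg_zero] at h
  conv_rhs => rw [← h]
  rw [map_measureReal_apply measurable_neg measurableSet_Ici]
  congr 1
  ext x
  simp

lemma gaussTail_eq_gaussian_integral (t : ℝ) :
    gaussTail t = (√Real.pi)⁻¹ * ∫ w in Ioi (√t), Real.exp (-1 * w ^ 2) := by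
  have hc : ∫ x in Ioi (√2 * √t), gaussianPDFReal 0 1 x =
      √2 * ∫ w in Ioi (√t), gaussianPDFReal 0 1 (√2 * w) := by
    rw [integral_comp_mul_left_Ioi (fun x => gaussianPDFReal 0 1 x) _ (by positivity)]
    rw [smul_eq_mul, mul_inv_cancel_left₀ (by positivity)]
  rw [gaussTail, cdf_eq_real, gaussianReal_real_Iic_neg, Measure.real,
    gaussianReal_apply_eq_integral _ one_ne_zero, ENNReal.toReal_ofReal
      (setIntegral_nonneg measurableSet_Ici fun x _ => gaussianPDFReal_nonneg _ _ _),
    integral_Ici_eq_integral_Ioi, Real.sqrt_mul (by norm_num), hc, ← integral_const_mul,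
    ← integral_const_mul]
  refine setIntegral_congr_fun measurableSet_Ioi fun w _ => ?_
  simp only [gaussianPDFReal, NNReal.coe_one, mul_one, sub_zero, mul_pow]
  rw [Real.sq_sqrt (by norm_num), Real.sqrt_mul (by norm_num), mul_inv, ← mul_assoc, ← mul_assoc,
    mul_inv_cancel₀ (by positivity), one_mul]
  congr 2
  ring

/-- Substitute u = w² in the Gaussian tail. In this form exponential integrals against the tail
reduce, by Fubini, to those of a Gamma density. -/
lemma gaussTail_eq_integral {t : ℝ} (ht : 0 ≤ t) :
    gaussTail t = ∫ u in Ioi t, tailDens u := by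
  rw [gaussTail_eq_gaussian_integral t,
    ← integral_comp_rpow_Ioi_of_pos' (g := tailDens) (p := 2) two_pos ht, ← integral_const_mul,
    show t ^ (2 : ℝ)⁻¹ = √t by rw [Real.sqrt_eq_rpow]; norm_num]
  refine setIntegral_congr_fun measurableSet_Ioi fun w hw => ?_
  have hw0 : 0 < w := (Real.sqrt_nonneg t).trans_lt hw
  have hpi := Real.pi_pos
  simp only [tailDens, smul_eq_mul]
  norm_num
  rw [Real.sqrt_mul hpi.le, Real.sqrt_sq hw0.le]
  field_simp

lemma tailDens_nonneg (u : ℝ) : 0 ≤ tailDens u := by unfold tailDens; positivity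

@[fun_prop]
lemma measurable_tailDens : Measurable tailDens := by unfold tailDens; fun_prop

lemma tailDens_eq_rpow {u : ℝ} (hu : 0 < u) :
    tailDens u = (2 * √Real.pi)⁻¹ * (Real.exp (-u) * u ^ ((1 / 2 : ℝ) - 1)) := by
  have hpi := Real.pi_pos
  rw [tailDens, show (1 / 2 : ℝ) - 1 = -(1 / 2) by norm_num, Real.rpow_neg hu.le,
    ← Real.sqrt_eq_rpow, Real.sqrt_mul hpi.le]
  field_simp

lemma integrableOn_tailDens : IntegrableOn tailDens (Ioi 0) := by
  have := (Real.GammaIntegral_convergent (s := 1 / 2) (by norm_num)).const_mul (2 * √Real.pi)⁻¹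
  exact (integrableOn_congr_fun (fun u hu => tailDens_eq_rpow hu) measurableSet_Ioi).2 this

/-- Mills' ratio bound. -/
lemma gaussTail_le_tailDens {t : ℝ} (ht : 0 < t) : gaussTail t ≤ tailDens t := by
  have hpi := Real.pi_pos
  rw [gaussTail_eq_integral ht.le]
  calc ∫ u in Ioi t, tailDens u ≤ ∫ u in Ioi t, Real.exp (-u) * (2 * √(Real.pi * t))⁻¹ := by
        refine setIntegral_mono_on (integrableOn_tailDens.mono_set (Ioi_subset_Ioi ht.le))
          ((integrableOn_exp_neg_Ioi t).mul_const _) measurableSet_Ioi fun u hu => ?_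
        rw [tailDens, div_eq_mul_inv]
        have : t < u := hu
        gcongr
    _ = tailDens t := by
        rw [integral_mul_const, integral_exp_neg_Ioi, tailDens, div_eq_mul_inv]

/-- What the tail misses from 1/2 is a Gaussian integral over (0, √t). Rescaling it to (0, 1)
produces the x-integral in G. -/
lemma half_sub_gaussTail {t : ℝ} (ht : 0 ≤ t) :
    1 / 2 - gaussTail t = √(t / Real.pi) * ∫ x in Ioo (0 : ℝ) 1, Real.exp (-(x ^ 2 * t)) := by
  have hint : IntegrableOn (fun w : ℝ => Real.exp (-1 * w ^ 2)) (Ioi 0) :=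
    (integrable_exp_neg_mul_sq one_pos).integrableOn
  have h0 := integral_gaussian_Ioi 1
  have hsplit : ∫ w in Ioi (0 : ℝ), Real.exp (-1 * w ^ 2) =
      (∫ w in (0 : ℝ)..√t, Real.exp (-1 * w ^ 2)) + ∫ w in Ioi (√t), Real.exp (-1 * w ^ 2) := by
    rw [intervalIntegral.integral_interval_add_Ioi hint
      (hint.mono_set (Ioi_subset_Ioi (Real.sqrt_nonneg t)))]
  have hscale : ∫ w in (0 : ℝ)..√t, Real.exp (-1 * w ^ 2) =
      √t * ∫ x in (0 : ℝ)..1, Real.exp (-(x ^ 2 * t)) := by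
    have := intervalIntegral.mul_integral_comp_mul_left (a := 0) (b := 1) (c := √t)
      (f := fun w : ℝ => Real.exp (-1 * w ^ 2))
    rw [mul_zero, mul_one] at this
    rw [← this]
    congr 2
    ext x
    congr 1
    rw [mul_pow, Real.sq_sqrt ht]
    ring
  have hpi := Real.pi_pos
  rw [gaussTail_eq_gaussian_integral t, ← integral_Ioc_eq_integral_Ioo,
    ← intervalIntegral.integral_of_le zero_le_one, Real.sqrt_div' _ hpi.le]
  rw [div_one, hsplit, hscale] at h0
  have hsp : √Real.pi ≠ 0 := by positivity
  have : ∫ w in Ioi (√t), Real.exp (-1 * w ^ 2) =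
      √Real.pi / 2 - √t * ∫ x in (0 : ℝ)..1, Real.exp (-(x ^ 2 * t)) := by linarith
  rw [this]
  generalize ∫ x in (0 : ℝ)..1, Real.exp (-(x ^ 2 * t)) = I
  field_simp
  ring

/-! ### The normal walk -/

section

variable (δ : ℝ) (σ : ℝ≥0)

lemma hasLaw_psum (n : ℕ) :
    HasLaw (fun x : ℕ → ℝ => psum x n) (gaussianReal (n * δ) (n * σ ^ 2))
      (iid (gaussianReal δ (σ ^ 2))) := by
  refine ⟨by fun_prop, ?_⟩
  induction n with
  | zero =>
    simp only [psum_zero, Nat.cast_zero, zero_mul, gaussianReal_zero_var]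
    rw [Measure.map_const]
    simp
  | succ n ih =>
    have hind := (iIndepFun_iid (gaussianReal δ (σ ^ 2))).indepFun_sum_range_succ
      (fun i => measurable_pi_apply i) n
    have hsum : (∑ j ∈ Finset.range n, fun x : ℕ → ℝ => x j) = fun x => psum x n := by
      ext x; simp [psum]
    rw [hsum] at hind
    have := gaussianReal_add_gaussianReal_of_indepFun hind ih
      (measurePreserving_eval_infinitePi (fun _ : ℕ => gaussianReal δ (σ ^ 2)) n).map_eq
    convert! this using 2
    · ext x; simp [psum_succ]
    · push_cast; ring
    · push_cast; ring

variable {δ σ}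

lemma driftRatio_pos (hδ : δ ≠ 0) (hσ : 0 < σ) : 0 < driftRatio δ σ := by
  unfold driftRatio; positivity

lemma sqrt_two_mul_driftRatio (hσ : 0 < σ) (n : ℕ) :
    √(2 * (driftRatio δ σ * n)) = |δ| * √n / σ := by
  have hσ' : (0 : ℝ) < σ := hσ
  rw [show 2 * (driftRatio δ σ * n) = (|δ| / σ) ^ 2 * n by
    rw [driftRatio, div_pow, sq_abs]; field_simp]
  rw [Real.sqrt_mul (by positivity), Real.sqrt_sq (by positivity)]
  ring

lemma gaussianReal_zero_one_Iio (a : ℝ) :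
    (gaussianReal 0 1).real (Iio a) = (gaussianReal 0 1).real (Iic a) := by
  have := nullSingletonClass_gaussianReal (μ := 0) (v := 1) one_ne_zero
  exact measureReal_congr Iio_ae_eq_Iic

/-- S_n is distributed as nδ + √n σ N with N standard normal. The case n = 0 must be left out: S_0 =
0 is never negative, while the right side would be 1/2. -/
lemma negProb_eq (hσ : 0 < σ) {n : ℕ} (hn : 1 ≤ n) :
    negProb (gaussianReal δ (σ ^ 2)) n = cdf (gaussianReal 0 1) (-(δ * √n / σ)) := by
  have hσ' : (0 : ℝ) < σ := hσ
  have hn' : (0 : ℝ) < n := by exact_mod_cast hn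
  have hc : 0 < √n * σ := by positivity
  have h := (gaussianReal_add_const (gaussianReal_const_mul
    (HasLaw.id (μ := gaussianReal 0 1)) (√n * σ)) (n * δ))
  have hv : NNReal.mk ((√n * σ) ^ 2) (sq_nonneg _) * 1 = n * σ ^ 2 := by
    ext
    simp [mul_pow, Real.sq_sqrt hn'.le]
  rw [hv, mul_zero, zero_add] at h
  rw [negProb, (hasLaw_psum δ σ n).measureReal_eq (p := fun y => y < 0) measurableSet_Iio,
    ← h.measureReal_eq (p := fun y => y < 0) measurableSet_Iio, cdf_eq_real,
    ← gaussianReal_zero_one_Iio]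
  congr 1
  ext x
  simp only [mem_ofPred_eq, id, mem_Iio]
  rw [show -(δ * √n / σ) = -(n * δ) / (√n * σ) by
    have := Real.mul_self_sqrt hn'.le
    field_simp
    rw [sq, this], lt_div_iff₀ hc]
  constructor <;> intro h <;> linarith

lemma negProb_of_pos (hδ : 0 < δ) (hσ : 0 < σ) {n : ℕ} (hn : 1 ≤ n) :
    negProb (gaussianReal δ (σ ^ 2)) n = gaussTail (driftRatio δ σ * n) := by
  rw [negProb_eq hσ hn, gaussTail, sqrt_two_mul_driftRatio hσ, abs_of_pos hδ]

lemma negProb_of_neg (hδ : δ < 0) (hσ : 0 < σ) {n : ℕ} (hn : 1 ≤ n) :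
    negProb (gaussianReal δ (σ ^ 2)) n = 1 - gaussTail (driftRatio δ σ * n) := by
  rw [negProb_eq hσ hn, gaussTail, sqrt_two_mul_driftRatio hσ, abs_of_neg hδ]
  set a := -δ * √n / σ
  rw [show -(δ * √n / σ) = a by simp only [a]; ring]
  rw [cdf_eq_real, cdf_eq_real, gaussianReal_real_Iic_neg, ← gaussianReal_zero_one_Iio,
    ← compl_Iio, probReal_compl_eq_one_sub measurableSet_Iio]
  ring

lemma negProb_sign (hδ : δ ≠ 0) (hσ : 0 < σ) {n : ℕ} (hn : 1 ≤ n) :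
    negProb (gaussianReal δ (σ ^ 2)) n =
      1 / 2 - Real.sign δ * (1 / 2 - gaussTail (driftRatio δ σ * n)) := by
  rcases hδ.lt_or_gt with h | h
  · rw [negProb_of_neg h hσ hn, Real.sign_of_neg h]; ring
  · rw [negProb_of_pos h hσ hn, Real.sign_of_pos h]; ring

end

lemma gaussTail_le_half (t : ℝ) : gaussTail t ≤ 1 / 2 := by
  rcases le_total 0 t with ht | ht
  · have := half_sub_gaussTail ht
    have h2 : 0 ≤ √(t / Real.pi) * ∫ x in Ioo (0 : ℝ) 1, Real.exp (-(x ^ 2 * t)) :=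
      mul_nonneg (Real.sqrt_nonneg _) (setIntegral_nonneg measurableSet_Ioo fun x _ =>
        (Real.exp_pos _).le)
    linarith
  -- For t ≤ 0 the real square root takes the default value 0.
  · have h1 : gaussTail t = gaussTail 0 := by
      rw [gaussTail, gaussTail, Real.sqrt_eq_zero_of_nonpos (by linarith), mul_zero,
        Real.sqrt_zero]
    have := half_sub_gaussTail le_rfl
    rw [zero_div, Real.sqrt_zero, zero_mul] at this
    linarith

/-- The series `∑ zⁿ/n (1/2 - Φ(-√(2qn)))`. -/
def coreSeries (q : ℝ) (z : ℂ) : ℂ := ∑' n : ℕ, (((1 / 2 - gaussTail (q * n)) / n : ℝ) : ℂ) * z ^ n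

lemma summable_coreSeries (q : ℝ) {z : ℂ} (hz : ‖z‖ < 1) :
    Summable fun n : ℕ => (((1 / 2 - gaussTail (q * n)) / n : ℝ) : ℂ) * z ^ n := by
  refine (summable_norm_mul_pow_of_bounded (C := 1)
    (abs_div_natCast_le (p := fun n => 1 / 2 - gaussTail (q * n)) fun n => ?_) hz).of_norm
  have h1 := gaussTail_le_half (q * n)
  have h2 := gaussTail_nonneg (q * n)
  rw [abs_of_nonneg (by linarith)]
  linarith

/-- The driftless part 1/2 of P(S_n < 0) sums to the logarithm, the source of the square root in
(a). The sign of the drift only affects the remainder. -/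
lemma spitzerSeries_gaussian {δ : ℝ} {σ : ℝ≥0} (hδ : δ ≠ 0) (hσ : 0 < σ) {z : ℂ} (hz : ‖z‖ < 1) :
    spitzerSeries (gaussianReal δ (σ ^ 2)) z =
      -(1 / 2) * Complex.log (1 - z) - (Real.sign δ : ℂ) * coreSeries (driftRatio δ σ) z := by
  have h1 := Complex.hasSum_taylorSeries_neg_log hz
  have h2 := (summable_coreSeries (driftRatio δ σ) hz).hasSum
  have h3 := (h1.mul_left (1 / 2 : ℂ)).sub (h2.mul_left (Real.sign δ : ℂ))
  rw [spitzerSeries, coreSeries, show -(1 / 2) * Complex.log (1 - z) =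
    1 / 2 * -Complex.log (1 - z) by ring, ← h3.tsum_eq]
  refine tsum_congr fun n => ?_
  rcases Nat.eq_zero_or_pos n with rfl | hn
  · simp
  · rw [negProb_sign hδ hσ hn]
    push_cast
    ring

lemma tsum_epochProb_gaussian {δ : ℝ} {σ : ℝ≥0} (hδ : δ ≠ 0) (hσ : 0 < σ) {z : ℂ}
    (hz : ‖z‖ < 1) :
    ∑' n, (epochProb (gaussianReal δ (σ ^ 2)) n : ℂ) * z ^ n =
      1 - (1 - z) ^ (1 / 2 : ℂ) *
        Complex.exp ((Real.sign δ : ℂ) * coreSeries (driftRatio δ σ) z) := by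
  have hz1 : 1 - z ≠ 0 := by
    intro h0
    have : z = 1 := by linear_combination -h0
    simp [this] at hz
  rw [tsum_epochProb _ hz, spitzerSeries_gaussian hδ hσ hz, Complex.cpow_def_of_ne_zero hz1,
    ← Complex.exp_add]
  congr 2
  ring

/-! ### The double integral -/

section

variable {δ : ℝ} {σ : ℝ≥0}

lemma kernelG_eq (δ : ℝ) (σ : ℝ≥0) (z : ℂ) (x y : ℝ) :
    kernelG δ σ z x y = z * (Real.exp (-(driftRatio δ σ * (y ^ 2 + x ^ 2))) : ℂ) /
      (1 - z * (Real.exp (-(driftRatio δ σ * (y ^ 2 + x ^ 2))) : ℂ)) := by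
  rw [kernelG, driftRatio, sq_abs, div_mul_eq_mul_div]

lemma norm_mul_exp_le {q : ℝ} (hq : 0 ≤ q) (z : ℂ) (x y : ℝ) :
    ‖z * (Real.exp (-(q * (y ^ 2 + x ^ 2))) : ℂ)‖ ≤ ‖z‖ := by
  rw [norm_mul, Complex.norm_real, Real.norm_eq_abs, Real.abs_exp]
  exact mul_le_of_le_one_right (norm_nonneg _) (Real.exp_le_one_iff.2 (by
    have := mul_nonneg hq (add_nonneg (sq_nonneg y) (sq_nonneg x)); linarith))

lemma one_sub_ne_zero_of_norm_lt {w : ℂ} (hw : ‖w‖ < 1) : 1 - w ≠ 0 := by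
  intro h0
  have : w = 1 := by linear_combination -h0
  simp [this] at hw

/-- The denominator is at least 1 - |z| in modulus and the numerator at most e^{-qy²}, while x
ranges over a bounded interval. -/
lemma integrableOn_kernelG (hδ : δ ≠ 0) (hσ : 0 < σ) {z : ℂ} (hz : ‖z‖ < 1) :
    IntegrableOn (fun p : ℝ × ℝ => kernelG δ σ z p.1 p.2) (Ioo (0 : ℝ) 1 ×ˢ Ioi (0 : ℝ)) := by
  have hq := driftRatio_pos hδ hσ
  simp_rw [kernelG_eq]
  set q := driftRatio δ σ
  have hg : Integrable (fun y : ℝ => Real.exp (-q * y ^ 2)) (volume.restrict (Ioi 0)) :=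
    (integrable_exp_neg_mul_sq hq).integrableOn
  have h2 := (hg.comp_snd (volume.restrict (Ioo (0 : ℝ) 1))).const_mul (1 - ‖z‖)⁻¹
  rw [IntegrableOn, Measure.volume_eq_prod, ← Measure.prod_restrict]
  refine h2.mono ?_ (Eventually.of_forall fun p => ?_)
  · refine Continuous.aestronglyMeasurable (Continuous.div (by fun_prop) (by fun_prop) fun p => ?_)
    exact one_sub_ne_zero_of_norm_lt ((norm_mul_exp_le hq.le z p.1 p.2).trans_lt hz)
  · have h1 : 0 < 1 - ‖z‖ := by linarith
    have h3 : 1 - ‖z‖ ≤ ‖1 - z * (Real.exp (-(q * (p.2 ^ 2 + p.1 ^ 2))) : ℂ)‖ := by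
      have := norm_sub_norm_le (1 : ℂ) (z * (Real.exp (-(q * (p.2 ^ 2 + p.1 ^ 2))) : ℂ))
      rw [norm_one] at this
      linarith [norm_mul_exp_le hq.le z p.1 p.2]
    rw [norm_div, norm_mul, norm_mul, Complex.norm_real, Real.norm_eq_abs, Real.abs_exp, norm_inv,
      Real.norm_of_nonneg h1.le, Real.norm_of_nonneg (Real.exp_pos _).le, div_eq_inv_mul]
    have h4 : ‖z‖ * Real.exp (-(q * (p.2 ^ 2 + p.1 ^ 2))) ≤ Real.exp (-q * p.2 ^ 2) := by
      rw [← one_mul (Real.exp (-q * p.2 ^ 2))]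
      refine mul_le_mul hz.le (Real.exp_le_exp.2 ?_) (Real.exp_pos _).le zero_le_one
      have := mul_nonneg hq.le (sq_nonneg p.1)
      linarith
    gcongr

lemma hasSum_kernelG (hδ : δ ≠ 0) (hσ : 0 < σ) {z : ℂ} (hz : ‖z‖ < 1) (x y : ℝ) :
    HasSum (fun n : ℕ => z ^ (n + 1) *
      (Real.exp (-((n + 1 : ℕ) * driftRatio δ σ * (y ^ 2 + x ^ 2))) : ℂ)) (kernelG δ σ z x y) := by
  have hq := driftRatio_pos hδ hσ
  rw [kernelG_eq]
  set q := driftRatio δ σ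
  have h := (hasSum_geometric_of_norm_lt_one ((norm_mul_exp_le hq.le z x y).trans_lt hz)).mul_left
    (z * (Real.exp (-(q * (y ^ 2 + x ^ 2))) : ℂ))
  rw [div_eq_mul_inv]
  convert! h using 2 with n
  rw [← pow_succ', mul_pow, ← Complex.ofReal_pow, ← Real.exp_nat_mul]
  congr 4
  ring

lemma integral_kernelG (hδ : δ ≠ 0) (hσ : 0 < σ) {z : ℂ} (hz : ‖z‖ < 1) (x : ℝ) :
    ∫ y in Ioi (0 : ℝ), kernelG δ σ z x y = ∑' n : ℕ, z ^ (n + 1) *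
      ((√(Real.pi / ((n + 1 : ℕ) * driftRatio δ σ)) / 2 *
        Real.exp (-((n + 1 : ℕ) * driftRatio δ σ * x ^ 2)) : ℝ) : ℂ) := by
  have hq := driftRatio_pos hδ hσ
  simp_rw [← (hasSum_kernelG hδ hσ hz x _).tsum_eq]
  set q := driftRatio δ σ
  have hsplit : ∀ (n : ℕ) (y : ℝ), Real.exp (-((n + 1 : ℕ) * q * (y ^ 2 + x ^ 2))) =
      Real.exp (-((n + 1 : ℕ) * q) * y ^ 2) * Real.exp (-((n + 1 : ℕ) * q * x ^ 2)) := by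
    intro n y
    rw [← Real.exp_add]
    congr 1
    ring
  have hpos : ∀ n : ℕ, 0 < (n + 1 : ℕ) * q := fun n => by positivity
  have hreal : ∀ n : ℕ, ∫ y in Ioi (0 : ℝ), Real.exp (-((n + 1 : ℕ) * q * (y ^ 2 + x ^ 2))) =
      √(Real.pi / ((n + 1 : ℕ) * q)) / 2 * Real.exp (-((n + 1 : ℕ) * q * x ^ 2)) := by
    intro n
    simp_rw [hsplit]
    rw [integral_mul_const, integral_gaussian_Ioi]
  have hint : ∀ n : ℕ, Integrable (fun y : ℝ => z ^ (n + 1) *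
      (Real.exp (-((n + 1 : ℕ) * q * (y ^ 2 + x ^ 2))) : ℂ)) (volume.restrict (Ioi 0)) := by
    intro n
    exact Integrable.const_mul (Integrable.ofReal ((((integrable_exp_neg_mul_sq
      (hpos n)).integrableOn).mul_const _).congr (ae_of_all _ fun y => (hsplit n y).symm))) _
  rw [← integral_tsum_of_summable_integral_norm hint]
  · refine tsum_congr fun n => ?_
    rw [integral_const_mul, integral_complex_ofReal, hreal]
  · have hn : ∀ n : ℕ, ∫ y in Ioi (0 : ℝ), ‖z ^ (n + 1) *
        (Real.exp (-((n + 1 : ℕ) * q * (y ^ 2 + x ^ 2))) : ℂ)‖ =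
        ‖z‖ ^ (n + 1) * (√(Real.pi / ((n + 1 : ℕ) * q)) / 2 *
          Real.exp (-((n + 1 : ℕ) * q * x ^ 2))) := by
      intro n
      rw [← hreal, ← integral_const_mul]
      congr 1
      ext y
      rw [norm_mul, norm_pow, Complex.norm_real, Real.norm_eq_abs, Real.abs_exp]
    simp_rw [hn]
    refine Summable.of_nonneg_of_le (fun n => by positivity) (fun n => ?_)
      (((summable_nat_add_iff 1).2 (summable_geometric_of_lt_one (norm_nonneg z) hz)).mul_right
        (√(Real.pi / q) / 2))
    refine mul_le_mul_of_nonneg_left ?_ (by positivity)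
    refine (mul_le_of_le_one_right (by positivity) (Real.exp_le_one_iff.2 ?_)).trans ?_
    · have := mul_nonneg (hpos n).le (sq_nonneg x)
      linarith
    · have hpi := Real.pi_pos
      have : q ≤ (n + 1 : ℕ) * q := le_mul_of_one_le_left hq.le (by simp)
      gcongr

/-- In the m-th term of the geometric expansion the y-integral is a half Gaussian, √(π/(mq))/2, and
the x-integral is the one in `half_sub_gaussTail` at t = qm. -/
lemma funG_eq_coreSeries (hδ : δ ≠ 0) (hσ : 0 < σ) {z : ℂ} (hz : ‖z‖ < 1) :
    funG δ σ z = coreSeries (driftRatio δ σ) z := by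
  have hq := driftRatio_pos hδ hσ
  have hpi := Real.pi_pos
  have hc : |δ| ^ 2 / (Real.pi * (σ : ℝ) ^ 2) = 2 * driftRatio δ σ / Real.pi := by
    have : (0 : ℝ) < σ := hσ
    rw [driftRatio, sq_abs]
    field_simp
  rw [funG, hc, coreSeries, (summable_coreSeries _ hz).tsum_eq_zero_add]
  simp_rw [integral_kernelG hδ hσ hz]
  set q := driftRatio δ σ
  have hpos : ∀ n : ℕ, 0 < (n + 1 : ℕ) * q := fun n => by positivity
  have hcont : ∀ n : ℕ, Continuous fun x : ℝ => Real.exp (-((n + 1 : ℕ) * q * x ^ 2)) := by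
    intro n; fun_prop
  have hI : ∀ n : ℕ, IntegrableOn (fun x : ℝ => Real.exp (-((n + 1 : ℕ) * q * x ^ 2)))
      (Ioo 0 1) := fun n =>
    ((hcont n).integrableOn_Icc (a := 0) (b := 1)).mono_set Ioo_subset_Icc_self
  have hint : ∀ n : ℕ, Integrable (fun x : ℝ => z ^ (n + 1) *
      ((√(Real.pi / ((n + 1 : ℕ) * q)) / 2 * Real.exp (-((n + 1 : ℕ) * q * x ^ 2)) : ℝ) : ℂ))
      (volume.restrict (Ioo 0 1)) := fun n =>
    Integrable.const_mul (Integrable.ofReal ((hI n).const_mul _)) _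
  have hle : ∀ (n : ℕ), ∫ x in Ioo (0 : ℝ) 1, Real.exp (-((n + 1 : ℕ) * q * x ^ 2)) ≤ 1 := by
    intro n
    have : ∫ x in Ioo (0 : ℝ) 1, (1 : ℝ) = 1 := by simp
    refine (integral_mono (hI n) (by simp) fun x => Real.exp_le_one_iff.2 ?_).trans this.le
    have := mul_nonneg (hpos n).le (sq_nonneg x)
    linarith
  rw [← integral_tsum_of_summable_integral_norm hint]
  · rw [← tsum_mul_left]
    simp only [CharP.cast_eq_zero, div_zero, Complex.ofReal_zero, zero_mul, zero_add]
    refine tsum_congr fun n => ?_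
    rw [integral_const_mul, integral_complex_ofReal, integral_const_mul,
      half_sub_gaussTail (by positivity)]
    have hint : ∫ x in Ioo (0 : ℝ) 1, Real.exp (-((n + 1 : ℕ) * q * x ^ 2)) =
        ∫ x in Ioo (0 : ℝ) 1, Real.exp (-(x ^ 2 * (q * (n + 1 : ℕ)))) := by
      congr 1; ext x; congr 1; ring
    rw [hint]
    generalize ∫ x in Ioo (0 : ℝ) 1, Real.exp (-(x ^ 2 * (q * (n + 1 : ℕ)))) = I
    have hreal : 2 * q / Real.pi * (√(Real.pi / ((n + 1 : ℕ) * q)) / 2) =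
        √(q * (n + 1 : ℕ) / Real.pi) / (n + 1 : ℕ) := by
      have hm : (0 : ℝ) < (n + 1 : ℕ) := by positivity
      generalize ((n + 1 : ℕ) : ℝ) = m at hm
      rw [Real.sqrt_div hpi.le, Real.sqrt_div' _ hpi.le, mul_comm q m]
      have h1 := Real.mul_self_sqrt hpi.le
      have h2 := Real.mul_self_sqrt (mul_nonneg hm.le hq.le)
      have h3 : 0 < √Real.pi := by positivity
      have h4 : 0 < √(m * q) := by positivity
      have h5 : q = √(m * q) * √(m * q) / m := by rw [h2]; field_simp
      generalize √(m * q) = b at *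
      generalize √Real.pi = a at *
      rw [h5, ← h1]
      field_simp
    have hreal' : 2 * q / Real.pi * (√(Real.pi / ((n + 1 : ℕ) * q)) / 2 * I) =
        √(q * (n + 1 : ℕ) / Real.pi) * I / (n + 1 : ℕ) := by
      rw [← mul_assoc, hreal]; ring
    rw [← hreal']
    push_cast
    ring
  · have hn : ∀ n : ℕ, ∫ x in Ioo (0 : ℝ) 1, ‖z ^ (n + 1) *
        ((√(Real.pi / ((n + 1 : ℕ) * q)) / 2 *
          Real.exp (-((n + 1 : ℕ) * q * x ^ 2)) : ℝ) : ℂ)‖ =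
        ‖z‖ ^ (n + 1) * (√(Real.pi / ((n + 1 : ℕ) * q)) / 2 *
          ∫ x in Ioo (0 : ℝ) 1, Real.exp (-((n + 1 : ℕ) * q * x ^ 2))) := by
      intro n
      rw [← integral_const_mul, ← integral_const_mul]
      congr 1
      ext x
      rw [norm_mul, norm_pow, Complex.norm_real, Real.norm_eq_abs, abs_of_nonneg (by positivity)]
    simp_rw [hn]
    refine Summable.of_nonneg_of_le (fun n => ?_) (fun n => ?_)
      (((summable_nat_add_iff 1).2 (summable_geometric_of_lt_one (norm_nonneg z) hz)).mul_right
        (√(Real.pi / q) / 2))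
    · have : 0 ≤ ∫ x in Ioo (0 : ℝ) 1, Real.exp (-((n + 1 : ℕ) * q * x ^ 2)) :=
        setIntegral_nonneg measurableSet_Ioo fun x _ => (Real.exp_pos _).le
      positivity
    · refine mul_le_mul_of_nonneg_left ?_ (by positivity)
      refine (mul_le_of_le_one_right (by positivity) (hle n)).trans ?_
      have : q ≤ (n + 1 : ℕ) * q := le_mul_of_one_le_left hq.le (by simp)
      gcongr

end

/-! ### Transfer to the path space -/

section

variable {Ω : Type*} [MeasurableSpace Ω] {P : Measure Ω} {X : ℕ → Ω → ℝ} {δ : ℝ} {σ : ℝ≥0}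

/-- Epoch and occupation time are functionals of the whole sequence of steps, so its joint law
allows all work to be done on the canonical path space. -/
lemma IsNormalSteps.hasLaw (h : IsNormalSteps P X δ σ) :
    HasLaw (fun ω i => X i ω) (iid (gaussianReal δ (σ ^ 2))) P := by
  have hm : ∀ i, AEMeasurable (X i) P := fun i => (h.law i).aemeasurable
  refine ⟨aemeasurable_pi_iff.2 hm, ?_⟩
  rw [h.indep.map_fun_eq_infinitePi_map₀' hm]
  congr 1
  ext1 i
  exact (h.law i).map_eq

lemma epochGenFun_eq (h : IsNormalSteps P X δ σ) {𝕜 : Type*} [RCLike 𝕜] (z : 𝕜) :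
    epochGenFun P X z =
      ∑' n : ℕ, ((epochProb (gaussianReal δ (σ ^ 2)) n : ℝ) : 𝕜) * z ^ n := by
  refine tsum_congr fun n => ?_
  have := h.hasLaw.measureReal_eq
    (p := fun x => descendingEpoch (fun i (x : ℕ → ℝ) => x i) x = n)
    (measurableSet_descendingEpoch_eq n)
  rw [epochProb, ← this]
  rfl

lemma epochGenFun_complex (hδ : δ ≠ 0) (hσ : 0 < σ) (h : IsNormalSteps P X δ σ) {z : ℂ}
    (hz : ‖z‖ < 1) :
    epochGenFun P X z =
      1 - (1 - z) ^ (1 / 2 : ℂ) * Complex.exp ((Real.sign δ : ℂ) * funG δ σ z) := by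
  rw [epochGenFun_eq h, funG_eq_coreSeries hδ hσ hz]
  exact tsum_epochProb_gaussian hδ hσ hz

end

/-! ### Laplace transforms -/

/-- The closed half-plane is needed since characteristic functions are the case s = -iξ. There 1 +
s, and likewise 1 + √(1+s), stay off the branch cut. -/
lemma one_add_mem_slitPlane {s : ℂ} (hs : 0 ≤ s.re) : 1 + s ∈ Complex.slitPlane := by
  left
  simp only [Complex.add_re, Complex.one_re]
  linarith

/-- The principal square root of `1 + s`. -/
def sqrtOneAdd (s : ℂ) : ℂ := (1 + s) ^ (2⁻¹ : ℂ)

lemma sqrtOneAdd_sq (s : ℂ) : sqrtOneAdd s ^ 2 = 1 + s := Complex.cpow_ofNat_inv_pow _ 2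

lemma sqrtOneAdd_re_pos {s : ℂ} (hs : 0 ≤ s.re) : 0 < (sqrtOneAdd s).re := by
  rw [sqrtOneAdd, Complex.cpow_inv_two_re]
  have := norm_nonneg (1 + s)
  simp only [Complex.add_re, Complex.one_re]
  exact Real.sqrt_pos.2 (by linarith)

lemma sqrtOneAdd_ne_zero {s : ℂ} (hs : 0 ≤ s.re) : sqrtOneAdd s ≠ 0 := by
  intro h
  have := sqrtOneAdd_re_pos hs
  simp [h] at this

lemma one_add_sqrtOneAdd_mem_slitPlane {s : ℂ} (hs : 0 ≤ s.re) :
    1 + sqrtOneAdd s ∈ Complex.slitPlane := one_add_mem_slitPlane (sqrtOneAdd_re_pos hs).le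

lemma one_add_sqrtOneAdd_ne_zero {s : ℂ} (hs : 0 ≤ s.re) : 1 + sqrtOneAdd s ≠ 0 :=
  Complex.slitPlane_ne_zero (one_add_sqrtOneAdd_mem_slitPlane hs)

lemma sqrtOneAdd_ofReal {s : ℝ} (hs : 0 ≤ s) : sqrtOneAdd s = (√(1 + s) : ℝ) := by
  rw [sqrtOneAdd, Real.sqrt_eq_rpow, Complex.ofReal_cpow (by linarith)]
  push_cast
  norm_num

lemma norm_cexp_neg_mul_le {s : ℂ} (hs : 0 ≤ s.re) {t : ℝ} (ht : 0 ≤ t) :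
    ‖Complex.exp (-(s * t))‖ ≤ 1 := by
  rw [Complex.norm_exp, Real.exp_le_one_iff]
  simp only [Complex.neg_re, Complex.mul_re, Complex.ofReal_re, Complex.ofReal_im, mul_zero,
    sub_zero]
  have := mul_nonneg hs ht
  linarith

/-- Substituting u = x² gives a Gaussian integral with complex parameter 1 + s. -/
lemma integral_cexp_mul_tailDens {s : ℂ} (hs : 0 ≤ s.re) :
    ∫ u in Ioi (0 : ℝ), Complex.exp (-(s * u)) * (tailDens u : ℂ) = (2 * sqrtOneAdd s)⁻¹ := by
  have hpi := Real.pi_pos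
  have hre : 0 < (1 + s).re := by
    simp only [Complex.add_re, Complex.one_re]; linarith
  rw [← integral_comp_rpow_Ioi_of_pos
    (g := fun u : ℝ => Complex.exp (-(s * u)) * (tailDens u : ℂ)) two_pos]
  have h1 : ∀ x ∈ Ioi (0 : ℝ), ((2 : ℝ) * x ^ ((2 : ℝ) - 1)) •
      (Complex.exp (-(s * (x ^ (2 : ℝ) : ℝ))) * (tailDens (x ^ (2 : ℝ)) : ℂ)) =
      ((√Real.pi : ℝ) : ℂ)⁻¹ * Complex.exp (-(1 + s) * (x : ℂ) ^ 2) := by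
    intro x hx
    have hx0 : (0 : ℝ) < x := hx
    have h2 : 2 * x * tailDens (x ^ 2) = (√Real.pi)⁻¹ * Real.exp (-x ^ 2) := by
      rw [tailDens, Real.sqrt_mul hpi.le, Real.sqrt_sq hx0.le]
      field_simp
    have h3 : x ^ (2 : ℝ) = x ^ 2 := by norm_num
    have h4 : (2 : ℝ) - 1 = 1 := by norm_num
    rw [h3, h4, Real.rpow_one, Complex.real_smul]
    calc ((2 * x : ℝ) : ℂ) * (Complex.exp (-(s * (x ^ 2 : ℝ))) * (tailDens (x ^ 2) : ℂ))
        = ((2 * x * tailDens (x ^ 2) : ℝ) : ℂ) * Complex.exp (-(s * (x ^ 2 : ℝ))) := by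
          push_cast; ring
      _ = _ := by
          rw [h2]
          push_cast
          rw [mul_assoc, ← Complex.exp_add]
          congr 2
          ring
  rw [setIntegral_congr_fun measurableSet_Ioi h1, integral_const_mul,
    integral_gaussian_complex_Ioi hre]
  have hne : 1 + s ≠ 0 := Complex.slitPlane_ne_zero (one_add_mem_slitPlane hs)
  have hsq : ((Real.pi : ℂ) / (1 + s)) ^ (1 / 2 : ℂ) = (√Real.pi : ℝ) * (sqrtOneAdd s)⁻¹ := by
    rw [sqrtOneAdd, ← Complex.inv_cpow _ _
      (Complex.slitPlane_arg_ne_pi (one_add_mem_slitPlane hs)), div_eq_mul_inv,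
      Complex.cpow_def_of_ne_zero (mul_ne_zero (by exact_mod_cast hpi.ne') (inv_ne_zero hne)),
      Complex.log_ofReal_mul hpi (inv_ne_zero hne), add_mul, Complex.exp_add,
      Complex.cpow_def_of_ne_zero (inv_ne_zero hne), Real.sqrt_eq_rpow, Real.rpow_def_of_pos hpi]
    push_cast
    norm_num
  have h0 : ((√Real.pi : ℝ) : ℂ) ≠ 0 := by
    rw [Complex.ofReal_ne_zero]; positivity
  rw [hsq, mul_inv]
  field_simp

lemma mul_tailDens_eq_rpow {u : ℝ} (hu : 0 < u) :
    u * tailDens u = (2 * √Real.pi)⁻¹ * (Real.exp (-u) * u ^ ((3 / 2 : ℝ) - 1)) := by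
  rw [tailDens_eq_rpow hu, show (3 / 2 : ℝ) - 1 = (1 / 2 - 1) + 1 by norm_num,
    Real.rpow_add hu, Real.rpow_one]
  ring

lemma integrableOn_mul_tailDens : IntegrableOn (fun u => u * tailDens u) (Ioi 0) := by
  have := (Real.GammaIntegral_convergent (s := 3 / 2) (by norm_num)).const_mul (2 * √Real.pi)⁻¹
  exact (integrableOn_congr_fun (fun u hu => mul_tailDens_eq_rpow hu) measurableSet_Ioi).2 this

lemma integral_mul_tailDens : ∫ u in Ioi (0 : ℝ), u * tailDens u = 1 / 4 := by
  rw [setIntegral_congr_fun measurableSet_Ioi fun u hu => mul_tailDens_eq_rpow hu,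
    integral_const_mul, ← Real.Gamma_eq_integral (by norm_num),
    show (3 / 2 : ℝ) = 1 / 2 + 1 by norm_num, Real.Gamma_add_one (by norm_num),
    Real.Gamma_one_half_eq]
  have : √Real.pi ≠ 0 := by have := Real.pi_pos; positivity
  field_simp
  norm_num

@[fun_prop]
lemma measurable_gaussTail : Measurable gaussTail := antitone_gaussTail.measurable

lemma integrableOn_gaussTail : IntegrableOn gaussTail (Ioi 0) := by
  refine Integrable.mono' integrableOn_tailDens (by fun_prop) ?_
  filter_upwards [ae_restrict_mem measurableSet_Ioi] with t ht
  rw [Real.norm_of_nonneg (gaussTail_nonneg t)]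
  exact gaussTail_le_tailDens ht

/-- Write the tail as the integral of its density and apply Fubini on 0 < t < u. The bound on f
makes u · `tailDens` u an integrable majorant. -/
lemma integral_mul_gaussTail {f : ℝ → ℂ} (hf : Continuous f) (hb : ∀ t, 0 < t → ‖f t‖ ≤ 1) :
    ∫ t in Ioi (0 : ℝ), f t * (gaussTail t : ℂ) =
      ∫ u in Ioi (0 : ℝ), (∫ t in (0 : ℝ)..u, f t) * (tailDens u : ℂ) := by
  set F : ℝ → ℝ → ℂ := fun t u => if t < u then f t * (tailDens u : ℂ) else 0 with hF
  have hF1 : ∀ t, F t = (Ioi t).indicator fun u => f t * (tailDens u : ℂ) := by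
    intro t; ext u; simp [hF, indicator_apply]
  have hF2 : ∀ u, (fun t => F t u) = (Iio u).indicator fun t => f t * (tailDens u : ℂ) := by
    intro u; ext t; simp [hF, indicator_apply]
  have hmeas : Measurable (Function.uncurry F) :=
    Measurable.ite (measurableSet_lt measurable_fst measurable_snd)
      (by fun_prop) measurable_const
  have hset : ∀ u : ℝ, Ioi 0 ∩ Iio u = Ioo 0 u := fun u => Ioi_inter_Iio
  have hfint : ∀ u : ℝ, IntegrableOn (fun t => f t * (tailDens u : ℂ)) (Ioo 0 u) := fun u =>
    ((by fun_prop : Continuous fun t => f t * (tailDens u : ℂ)).integrableOn_Icc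
      (a := 0) (b := u)).mono_set Ioo_subset_Icc_self
  have hint : Integrable (Function.uncurry F)
      ((volume.restrict (Ioi 0)).prod (volume.restrict (Ioi 0))) := by
    rw [integrable_prod_iff' hmeas.aestronglyMeasurable]
    constructor
    · refine Eventually.of_forall fun u => ?_
      change Integrable (fun t => F t u) _
      rw [hF2, integrable_indicator_iff measurableSet_Iio, IntegrableOn,
        Measure.restrict_restrict measurableSet_Iio, inter_comm, hset]
      exact hfint u
    · refine Integrable.mono' integrableOn_mul_tailDens
        (hmeas.norm.stronglyMeasurable.integral_prod_left.aestronglyMeasurable) ?_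
      filter_upwards [ae_restrict_mem measurableSet_Ioi] with u hu
      have hu0 : (0 : ℝ) < u := hu
      change ‖∫ t in Ioi 0, ‖F t u‖‖ ≤ _
      have h1 : (fun t => ‖F t u‖) = (Iio u).indicator fun t => ‖f t * (tailDens u : ℂ)‖ := by
        ext t
        rw [congrFun (hF2 u) t, norm_indicator_eq_indicator_norm]
      rw [h1, setIntegral_indicator measurableSet_Iio, hset]
      refine (norm_setIntegral_le_of_norm_le_const (C := tailDens u) (by simp) ?_).trans ?_
      · intro t ht
        rw [norm_norm, norm_mul, Complex.norm_real, Real.norm_of_nonneg (tailDens_nonneg u)]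
        exact mul_le_of_le_one_left (tailDens_nonneg u) (hb t ht.1)
      · rw [Real.volume_real_Ioo_of_le hu0.le, sub_zero, mul_comm]
  have hswap := integral_integral_swap hint
  have hL : ∫ t in Ioi (0 : ℝ), f t * (gaussTail t : ℂ) =
      ∫ t in Ioi (0 : ℝ), ∫ u in Ioi (0 : ℝ), F t u := by
    refine setIntegral_congr_fun measurableSet_Ioi fun t ht => ?_
    have ht0 : (0 : ℝ) < t := ht
    simp only [hF1]
    rw [setIntegral_indicator measurableSet_Ioi, Ioi_inter_Ioi, sup_eq_right.2 ht0.le,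
      integral_const_mul, integral_complex_ofReal, gaussTail_eq_integral ht0.le]
  have hR : ∫ u in Ioi (0 : ℝ), (∫ t in (0 : ℝ)..u, f t) * (tailDens u : ℂ) =
      ∫ u in Ioi (0 : ℝ), ∫ t in Ioi (0 : ℝ), F t u := by
    refine setIntegral_congr_fun measurableSet_Ioi fun u hu => ?_
    have hu0 : (0 : ℝ) < u := hu
    simp only [hF2]
    rw [setIntegral_indicator measurableSet_Iio, hset, integral_mul_const,
      ← integral_Ioc_eq_integral_Ioo, ← intervalIntegral.integral_of_le hu0.le]
  rw [hL, hR, hswap]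

lemma integrableOn_cexp_mul_ofReal {s : ℂ} (hs : 0 ≤ s.re) {g : ℝ → ℝ}
    (hg : IntegrableOn g (Ioi 0)) :
    IntegrableOn (fun t : ℝ => Complex.exp (-(s * t)) * (g t : ℂ)) (Ioi 0) := by
  refine Integrable.bdd_mul (c := 1) hg.ofReal
    (by fun_prop : Continuous fun t : ℝ => Complex.exp (-(s * t))).aestronglyMeasurable ?_
  filter_upwards [ae_restrict_mem measurableSet_Ioi] with t ht
  exact norm_cexp_neg_mul_le hs (le_of_lt ht)

lemma integral_cexp_mul_gaussTail {s : ℂ} (hs : 0 ≤ s.re) :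
    ∫ t in Ioi (0 : ℝ), Complex.exp (-(s * t)) * (gaussTail t : ℂ) =
      (2 * sqrtOneAdd s * (1 + sqrtOneAdd s))⁻¹ := by
  rw [integral_mul_gaussTail (by fun_prop) fun t ht => norm_cexp_neg_mul_le hs ht.le]
  -- The primitive of e^{-st} divides by s. At s = 0 the first moment 1/4 of `tailDens` takes its
  -- place.
  by_cases h0 : s = 0
  · subst h0
    have h1 : sqrtOneAdd 0 = 1 := by simp [sqrtOneAdd]
    simp only [zero_mul, neg_zero, Complex.exp_zero, intervalIntegral.integral_const, sub_zero,
      Complex.real_smul, mul_one, h1]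
    have := integral_mul_tailDens
    simp_rw [← Complex.ofReal_mul]
    rw [integral_complex_ofReal, this]
    push_cast
    norm_num
  · have h1 : ∀ u : ℝ, ∫ t in (0 : ℝ)..u, Complex.exp (-(s * t)) =
        (1 - Complex.exp (-(s * u))) / s := by
      intro u
      simp_rw [← neg_mul]
      rw [integral_exp_mul_complex (neg_ne_zero.2 h0)]
      simp only [Complex.ofReal_zero, mul_zero, Complex.exp_zero]
      field_simp
      ring
    have h2 : ∀ u : ℝ, (1 - Complex.exp (-(s * u))) / s * (tailDens u : ℂ) =
        s⁻¹ * (Complex.exp (-(0 * u)) * (tailDens u : ℂ) -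
          Complex.exp (-(s * u)) * (tailDens u : ℂ)) := by
      intro u
      simp only [zero_mul, neg_zero, Complex.exp_zero]
      ring
    simp_rw [h1, h2]
    rw [integral_const_mul, integral_sub
      (integrableOn_cexp_mul_ofReal (by simp) integrableOn_tailDens)
      (integrableOn_cexp_mul_ofReal hs integrableOn_tailDens),
      integral_cexp_mul_tailDens (by simp), integral_cexp_mul_tailDens hs]
    have h3 : sqrtOneAdd 0 = 1 := by simp [sqrtOneAdd]
    have h4 := sqrtOneAdd_ne_zero hs
    have h5 := one_add_sqrtOneAdd_ne_zero hs
    -- With w = √(1+s), the value (1 - 1/w)/(2s) simplifies through s = (w-1)(w+1).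
    have h6 : s = sqrtOneAdd s ^ 2 - 1 := by rw [sqrtOneAdd_sq]; ring
    rw [h3]
    field_simp
    linear_combination -h6

/-! ### The limit law -/

lemma lawA_density_eq {t : ℝ} (ht : 0 < t) :
    4 * gaussianPDFReal 0 1 (√(2 * t)) / √(2 * t) - 4 * cdf (gaussianReal 0 1) (-√(2 * t)) =
      4 * (tailDens t - gaussTail t) := by
  have hpi := Real.pi_pos
  have h1 : gaussianPDFReal 0 1 (√(2 * t)) = (√(2 * Real.pi))⁻¹ * Real.exp (-t) := by
    simp only [gaussianPDFReal, NNReal.coe_one, mul_one, sub_zero]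
    rw [Real.sq_sqrt (by positivity)]
    congr 2
    ring
  have h2 : √(2 * Real.pi) * √(2 * t) = 2 * √(Real.pi * t) := by
    rw [← Real.sqrt_mul (by positivity), show 2 * Real.pi * (2 * t) = 2 ^ 2 * (Real.pi * t) by ring,
      Real.sqrt_mul (by positivity), Real.sqrt_sq (by positivity)]
  rw [h1, tailDens, ← h2, gaussTail]
  field_simp

/-- This is Mills' ratio bound in disguise. It ensures that `ENNReal.ofReal` in the definition of
the law truncates nothing. -/
lemma lawA_density_nonneg {t : ℝ} (ht : 0 < t) :
    0 ≤ 4 * gaussianPDFReal 0 1 (√(2 * t)) / √(2 * t) -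
      4 * cdf (gaussianReal 0 1) (-√(2 * t)) := by
  rw [lawA_density_eq ht]
  linarith [gaussTail_le_tailDens ht]

lemma measurable_lawA_density : Measurable fun t : ℝ => ENNReal.ofReal
    (4 * gaussianPDFReal 0 1 (√(2 * t)) / √(2 * t) - 4 * cdf (gaussianReal 0 1) (-√(2 * t))) := by
  have : Measurable fun t : ℝ => 4 * gaussianPDFReal 0 1 (√(2 * t)) / √(2 * t) - 4 * gaussTail t :=
    by fun_prop
  exact this.ennreal_ofReal

lemma integral_lawA {E : Type*} [NormedAddCommGroup E] [NormedSpace ℝ E] (f : ℝ → E) :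
    ∫ t, f t ∂lawA = ∫ t in Ioi (0 : ℝ), (4 * (tailDens t - gaussTail t)) • f t := by
  rw [lawA, integral_withDensity_eq_integral_toReal_smul measurable_lawA_density
    (Eventually.of_forall fun t => ENNReal.ofReal_lt_top)]
  refine setIntegral_congr_fun measurableSet_Ioi fun t ht => ?_
  rw [ENNReal.toReal_ofReal (lawA_density_nonneg ht), lawA_density_eq ht]

/-- The Laplace transform of the law of `A` on the closed right half-plane. -/
lemma integral_cexp_lawA {s : ℂ} (hs : 0 ≤ s.re) :
    ∫ t, Complex.exp (-(s * t)) ∂lawA = 2 / (1 + sqrtOneAdd s) := by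
  have h1 : ∀ t : ℝ, (4 * (tailDens t - gaussTail t)) • Complex.exp (-(s * t)) =
      4 * (Complex.exp (-(s * t)) * (tailDens t : ℂ) -
        Complex.exp (-(s * t)) * (gaussTail t : ℂ)) := by
    intro t
    rw [Complex.real_smul]
    push_cast
    ring
  rw [integral_lawA]
  simp_rw [h1]
  rw [integral_const_mul, integral_sub (integrableOn_cexp_mul_ofReal hs integrableOn_tailDens)
    (integrableOn_cexp_mul_ofReal hs integrableOn_gaussTail), integral_cexp_mul_tailDens hs,
    integral_cexp_mul_gaussTail hs]
  have h4 := sqrtOneAdd_ne_zero hs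
  have h5 := one_add_sqrtOneAdd_ne_zero hs
  field_simp
  ring

lemma integral_exp_lawA {s : ℝ} (hs : 0 ≤ s) :
    ∫ t, Real.exp (-s * t) ∂lawA = 2 / (1 + √(1 + s)) := by
  have h := integral_cexp_lawA (s := (s : ℂ)) (by simpa using hs)
  rw [sqrtOneAdd_ofReal hs] at h
  have h1 : ∀ t : ℝ, Complex.exp (-((s : ℂ) * t)) = (Real.exp (-s * t) : ℝ) := by
    intro t; push_cast; congr 1; ring
  simp_rw [h1] at h
  rw [integral_complex_ofReal] at h
  exact_mod_cast h

lemma isProbabilityMeasure_lawA : IsProbabilityMeasure lawA := by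
  have h : ∫ t in Ioi (0 : ℝ), 4 * (tailDens t - gaussTail t) = 1 := by
    have h0 := integral_exp_lawA le_rfl
    rw [integral_lawA] at h0
    simp only [neg_zero, zero_mul, Real.exp_zero, smul_eq_mul, mul_one] at h0
    rw [h0]
    norm_num
  refine ⟨?_⟩
  rw [lawA, withDensity_apply _ MeasurableSet.univ, Measure.restrict_univ,
    setLIntegral_congr_fun measurableSet_Ioi fun t ht => by
      rw [lawA_density_eq ht], ← ofReal_integral_eq_lintegral_ofReal, h, ENNReal.ofReal_one]
  · exact (integrableOn_tailDens.sub integrableOn_gaussTail).const_mul 4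
  · filter_upwards [ae_restrict_mem measurableSet_Ioi] with t ht
    have := gaussTail_le_tailDens ht
    simp only [Pi.zero_apply]
    linarith

/-- The exponent in the infinitely divisible representation of the law of `A`. -/
def limitExponent (s : ℂ) : ℂ :=
  ∫ t in Ioi (0 : ℝ), (1 - Complex.exp (-(s * t))) / t * (gaussTail t : ℂ)

/-- Write (1 - e^{-st})/t as the integral of s e^{-θst} over θ in (0, 1) and swap. The inner
transform is then the θ-derivative of log(1 + √(1+θs)), so the integral telescopes. -/
lemma limitExponent_eq {s : ℂ} (hs : 0 ≤ s.re) :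
    limitExponent s = Complex.log (1 + sqrtOneAdd s) - Complex.log 2 := by
  have hre : ∀ θ : ℝ, 0 ≤ θ → 0 ≤ ((θ : ℂ) * s).re := by
    intro θ hθ
    simpa using mul_nonneg hθ hs
  have hint : Integrable (Function.uncurry fun t θ : ℝ =>
      s * (Complex.exp (-(θ * s * t)) * (gaussTail t : ℂ)))
      ((volume.restrict (Ioi 0)).prod (volume.restrict (Ioc 0 1))) := by
    refine Integrable.const_mul ?_ s
    have h1 := (integrableOn_gaussTail.ofReal (𝕜 := ℂ)).comp_fst (volume.restrict (Ioc (0 : ℝ) 1))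
    refine Integrable.bdd_mul (c := 1) h1 (by fun_prop : Continuous fun p : ℝ × ℝ =>
      Complex.exp (-(p.2 * s * p.1))).aestronglyMeasurable ?_
    rw [Measure.prod_restrict]
    filter_upwards [ae_restrict_mem (measurableSet_Ioi.prod measurableSet_Ioc)] with p hp
    exact norm_cexp_neg_mul_le (hre p.2 hp.2.1.le) (le_of_lt hp.1)
  have h1 : limitExponent s = ∫ t in Ioi (0 : ℝ), ∫ θ in Ioc (0 : ℝ) 1,
      s * (Complex.exp (-(θ * s * t)) * (gaussTail t : ℂ)) := by
    refine setIntegral_congr_fun measurableSet_Ioi fun t ht => ?_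
    have ht0 : (t : ℂ) ≠ 0 := by exact_mod_cast (ne_of_gt ht)
    rw [integral_const_mul, integral_mul_const, ← mul_assoc,
      ← intervalIntegral.integral_of_le zero_le_one]
    congr 1
    by_cases h0 : s = 0
    · simp [h0]
    · have : ∀ θ : ℝ, Complex.exp (-(θ * s * t)) = Complex.exp (-(s * t) * θ) := by
        intro θ; congr 1; ring
      simp_rw [this]
      rw [integral_exp_mul_complex (neg_ne_zero.2 (mul_ne_zero h0 ht0))]
      simp only [Complex.ofReal_zero, mul_zero, Complex.exp_zero, Complex.ofReal_one, mul_one]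
      field_simp
      ring
  have hderiv : ∀ θ : ℝ, 0 ≤ θ → HasDerivAt (fun θ : ℝ => Complex.log (1 + sqrtOneAdd (θ * s)))
      (s * (2 * sqrtOneAdd (θ * s) * (1 + sqrtOneAdd (θ * s)))⁻¹) θ := by
    intro θ hθ
    have h2 : HasDerivAt (fun w : ℂ => 1 + w * s) s (θ : ℂ) := by
      simpa using ((hasDerivAt_id (θ : ℂ)).mul_const s).const_add 1
    have h3 := ((h2.cpow_const (c := 2⁻¹) (one_add_mem_slitPlane (hre θ hθ))).const_add 1).clog
      (one_add_sqrtOneAdd_mem_slitPlane (hre θ hθ))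
    convert! h3.comp_ofReal using 1
    have hne := Complex.slitPlane_ne_zero (one_add_mem_slitPlane (hre θ hθ))
    rw [Complex.cpow_sub _ _ hne, Complex.cpow_one]
    change _ = 2⁻¹ * (sqrtOneAdd (θ * s) / (1 + θ * s)) * s / (1 + sqrtOneAdd (θ * s))
    rw [← sqrtOneAdd_sq (θ * s)]
    have h4 := sqrtOneAdd_ne_zero (hre θ hθ)
    have h5 := one_add_sqrtOneAdd_ne_zero (hre θ hθ)
    field_simp
  have hcont : ContinuousOn (fun θ : ℝ =>
      s * (2 * sqrtOneAdd (θ * s) * (1 + sqrtOneAdd (θ * s)))⁻¹) (Icc 0 1) := by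
    have hc : ContinuousOn (fun θ : ℝ => sqrtOneAdd (θ * s)) (Icc 0 1) := by
      unfold sqrtOneAdd
      exact ContinuousOn.cpow_const (by fun_prop) fun θ hθ => one_add_mem_slitPlane (hre θ hθ.1)
    refine continuousOn_const.mul (ContinuousOn.inv₀ (by fun_prop) fun θ hθ => ?_)
    exact mul_ne_zero (mul_ne_zero two_ne_zero (sqrtOneAdd_ne_zero (hre θ hθ.1)))
      (one_add_sqrtOneAdd_ne_zero (hre θ hθ.1))
  rw [h1, integral_integral_swap hint, setIntegral_congr_fun (g := fun θ : ℝ =>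
    s * (2 * sqrtOneAdd (θ * s) * (1 + sqrtOneAdd (θ * s)))⁻¹) measurableSet_Ioc fun θ hθ => by
      simp only
      rw [integral_const_mul, integral_cexp_mul_gaussTail (hre θ hθ.1.le)],
    ← intervalIntegral.integral_of_le zero_le_one,
    intervalIntegral.integral_eq_sub_of_hasDerivAt (fun θ hθ => hderiv θ (by
      rw [uIcc_of_le zero_le_one] at hθ; exact hθ.1))
      (ContinuousOn.intervalIntegrable (by rwa [uIcc_of_le zero_le_one]))]
  have h0 : sqrtOneAdd 0 = 1 := by simp [sqrtOneAdd]
  simp only [Complex.ofReal_one, one_mul, Complex.ofReal_zero, zero_mul, h0]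
  norm_num

lemma exp_neg_limitExponent {s : ℂ} (hs : 0 ≤ s.re) :
    Complex.exp (-limitExponent s) = ∫ t, Complex.exp (-(s * t)) ∂lawA := by
  rw [integral_cexp_lawA hs, limitExponent_eq hs, neg_sub, Complex.exp_sub,
    Complex.exp_log two_ne_zero, Complex.exp_log (one_add_sqrtOneAdd_ne_zero hs)]

/-! ### Riemann sums on the half-line -/

lemma ceil_div_eq_succ_iff {q t : ℝ} (hq : 0 < q) (n : ℕ) :
    ⌈t / q⌉₊ = n + 1 ↔ t ∈ Ioc (q * n) (q * (n + 1)) := by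
  rw [Nat.ceil_eq_iff (Nat.succ_ne_zero n), Nat.succ_sub_one, lt_div_iff₀ hq, div_le_iff₀ hq,
    mem_Ioc, mul_comm q, mul_comm q]
  push_cast
  rfl

/-- Riemann sums of a function dominated by a nonincreasing integrable function. -/
lemma tendsto_riemann_sum {E : Type*} [NormedAddCommGroup E] [NormedSpace ℝ E] [CompleteSpace E]
    {f : ℝ → E} {g : ℝ → ℝ} (hg : AntitoneOn g (Ioi 0)) (hgi : IntegrableOn g (Ioi 0))
    (hfg : ∀ t, 0 < t → ‖f t‖ ≤ g t) (hf : ContinuousOn f (Ioi 0)) :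
    Tendsto (fun q : ℝ => ∑' n : ℕ, q • f (q * (n + 1))) (𝓝[>] 0)
      (𝓝 (∫ t in Ioi (0 : ℝ), f t)) := by
  -- The Riemann sum is the integral of f at the right endpoint q⌈t/q⌉ of the cell of t. Right
  -- endpoints lie beyond t, so the nonincreasing g dominates for every mesh, even when f is
  -- singular at 0.
  have hbound : ∀ q : ℝ, 0 < q → ∀ t : ℝ, 0 < t → ‖f (q * ⌈t / q⌉₊)‖ ≤ g t := by
    intro q hq t ht
    have h1 : t ≤ q * ⌈t / q⌉₊ := by
      rw [mul_comm, ← div_le_iff₀ hq]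
      exact Nat.le_ceil _
    exact (hfg _ (ht.trans_le h1)).trans (hg ht (ht.trans_le h1) h1)
  have hmeas : ∀ q : ℝ, AEStronglyMeasurable (fun t => f (q * ⌈t / q⌉₊))
      (volume.restrict (Ioi 0)) := by
    intro q
    have h1 : StronglyMeasurable fun n : ℕ => f (q * n) := .of_discrete
    exact (h1.comp_measurable (Nat.measurable_ceil.comp (measurable_id.div_const q))
      ).aestronglyMeasurable
  have hint : ∀ q : ℝ, 0 < q → IntegrableOn (fun t => f (q * ⌈t / q⌉₊)) (Ioi 0) := by
    intro q hq
    refine Integrable.mono' hgi (hmeas q) ?_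
    filter_upwards [ae_restrict_mem measurableSet_Ioi] with t ht using hbound q hq t ht
  have hsum : ∀ q : ℝ, 0 < q →
      ∑' n : ℕ, q • f (q * (n + 1)) = ∫ t in Ioi (0 : ℝ), f (q * ⌈t / q⌉₊) := by
    intro q hq
    have hU : (⋃ n : ℕ, Ioc (q * n) (q * (n + 1))) = Ioi 0 := by
      ext t
      simp only [mem_iUnion, ← ceil_div_eq_succ_iff hq, mem_Ioi]
      constructor
      · rintro ⟨n, hn⟩
        have : 0 < ⌈t / q⌉₊ := by omega
        rw [Nat.ceil_pos] at this
        exact (div_pos_iff_of_pos_right hq).1 this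
      · intro ht
        have : 0 < ⌈t / q⌉₊ := Nat.ceil_pos.2 (div_pos ht hq)
        exact ⟨⌈t / q⌉₊ - 1, by omega⟩
    have hd : Pairwise (Function.onFun Disjoint fun n : ℕ => Ioc (q * n) (q * (n + 1))) := by
      intro m n hmn
      refine Set.disjoint_left.2 fun t hm hn => hmn ?_
      rw [← ceil_div_eq_succ_iff hq] at hm hn
      omega
    rw [← hU]
    have := integral_iUnion (fun n : ℕ => measurableSet_Ioc) hd (by rw [hU]; exact hint q hq)
    rw [this]
    refine tsum_congr fun n => ?_
    rw [setIntegral_congr_fun (g := fun _ => f (q * (n + 1))) measurableSet_Ioc fun t ht => by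
      rw [(ceil_div_eq_succ_iff hq n).2 ht]; push_cast; rfl]
    rw [setIntegral_const, Real.volume_real_Ioc_of_le (by nlinarith)]
    congr 1
    ring
  have hlim : Tendsto (fun q : ℝ => ∫ t in Ioi (0 : ℝ), f (q * ⌈t / q⌉₊)) (𝓝[>] 0)
      (𝓝 (∫ t in Ioi (0 : ℝ), f t)) := by
    refine tendsto_integral_filter_of_dominated_convergence g
      (Eventually.of_forall hmeas) ?_ hgi ?_
    · filter_upwards [self_mem_nhdsWithin] with q hq
      filter_upwards [ae_restrict_mem measurableSet_Ioi] with t ht using hbound q hq t ht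
    · filter_upwards [ae_restrict_mem measurableSet_Ioi] with t ht
      have ht0 : 0 < t := ht
      refine ((hf.continuousAt (Ioi_mem_nhds ht0)).tendsto).comp ?_
      have h1 : Tendsto (fun q : ℝ => t + q) (𝓝[>] 0) (𝓝 t) := by
        have : Continuous fun q : ℝ => t + q := by fun_prop
        simpa using (this.tendsto 0).mono_left (nhdsWithin_le_nhds (s := Ioi 0))
      refine tendsto_of_tendsto_of_tendsto_of_le_of_le' tendsto_const_nhds h1 ?_ ?_
      · filter_upwards [self_mem_nhdsWithin] with q hq
        rw [mul_comm, ← div_le_iff₀ hq]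
        exact Nat.le_ceil _
      · filter_upwards [self_mem_nhdsWithin] with q hq
        have hq0 : 0 < q := hq
        have := (Nat.ceil_lt_add_one (div_pos ht0 hq0).le).le
        calc q * ⌈t / q⌉₊ ≤ q * (t / q + 1) := by gcongr
          _ = t + q := by field_simp
  refine hlim.congr' ?_
  filter_upwards [self_mem_nhdsWithin] with q hq using (hsum q hq).symm

lemma continuousOn_gaussTail : ContinuousOn gaussTail (Ici 0) := by
  have h1 : Continuous fun t : ℝ => ∫ x in (0 : ℝ)..1, Real.exp (-(x ^ 2 * t)) :=
    intervalIntegral.continuous_parametric_intervalIntegral_of_continuous' (by fun_prop) 0 1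
  have h2 : Continuous fun t : ℝ =>
      1 / 2 - √(t / Real.pi) * ∫ x in (0 : ℝ)..1, Real.exp (-(x ^ 2 * t)) := by fun_prop
  refine h2.continuousOn.congr fun t ht => ?_
  have := half_sub_gaussTail ht
  rw [← integral_Ioc_eq_integral_Ioo, ← intervalIntegral.integral_of_le zero_le_one] at this
  linarith

lemma summable_gaussTail {q : ℝ} (hq : 0 < q) : Summable fun n : ℕ => gaussTail (q * n) := by
  rw [← summable_nat_add_iff 1]
  have hpi := Real.pi_pos
  have hgeo : Summable fun n : ℕ => (2 * √(Real.pi * q))⁻¹ * Real.exp (-q) ^ n :=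
    (summable_geometric_of_lt_one (Real.exp_pos _).le (Real.exp_lt_one_iff.2 (by linarith))).mul_left _
  refine Summable.of_nonneg_of_le (fun n => gaussTail_nonneg _) (fun n => ?_) hgeo
  have hn : (0 : ℝ) < (n + 1 : ℕ) := by positivity
  refine (gaussTail_le_tailDens (by positivity)).trans ?_
  rw [tailDens, div_eq_inv_mul, ← Real.exp_nat_mul]
  have h1 : q ≤ q * (n + 1 : ℕ) := le_mul_of_one_le_right hq.le (by simp)
  have h2 : -(q * (n + 1 : ℕ)) ≤ n * -q := by push_cast; linarith
  gcongr

/-! ### Convergence of the occupation time -/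

/-- From |e^{iξt} - 1| ≤ |ξ| t; the majorant is nonincreasing and integrable, as the Riemann sum
theorem requires. -/
lemma integrand_norm_le (ξ : ℝ) {t : ℝ} (ht : 0 < t) :
    ‖(1 - Complex.exp (-((-(ξ * Complex.I)) * t))) / t * (gaussTail t : ℂ)‖ ≤
      |ξ| * gaussTail t := by
  rw [norm_mul, norm_div, Complex.norm_real, Complex.norm_real,
    Real.norm_of_nonneg (gaussTail_nonneg t), Real.norm_of_nonneg ht.le]
  refine mul_le_mul_of_nonneg_right ?_ (gaussTail_nonneg t)
  rw [div_le_iff₀ ht, norm_sub_rev]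
  have := Real.norm_exp_I_mul_ofReal_sub_one_le (x := ξ * t)
  rw [Real.norm_eq_abs, abs_mul, abs_of_pos ht] at this
  rwa [show -((-(ξ * Complex.I)) * t) = Complex.I * ((ξ * t : ℝ) : ℂ) by push_cast; ring]

section

variable {δ : ℝ} {σ : ℝ≥0}

lemma summable_negProb (hδ : 0 < δ) (hσ : 0 < σ) :
    Summable (negProb (gaussianReal δ (σ ^ 2))) := by
  rw [← summable_nat_add_iff 1]
  refine ((summable_nat_add_iff 1).2 (summable_gaussTail (driftRatio_pos hδ.ne' hσ))).congr
    fun n => ?_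
  rw [negProb_of_pos hδ hσ (by omega)]

/-- The law of the normalized occupation time. -/
def occLaw (δ : ℝ) (σ : ℝ≥0) : Measure ℝ :=
  (iid (gaussianReal δ (σ ^ 2))).map fun x => driftRatio δ σ * (pathOcc x).toReal

lemma measurable_mul_pathOcc (q : ℝ) : Measurable fun x => q * (pathOcc x).toReal :=
  measurable_pathOcc.ennreal_toReal.const_mul q

instance (δ : ℝ) (σ : ℝ≥0) : IsProbabilityMeasure (occLaw δ σ) :=
  Measure.isProbabilityMeasure_map (measurable_mul_pathOcc _).aemeasurable

/-- This is exp(L(e^{iξq}) - L(1)), with each term multiplied and divided by q. The exponent becomes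
a right-endpoint Riemann sum of mesh q for `limitExponent` at s = -iξ. -/
lemma charFun_occLaw (hδ : 0 < δ) (hσ : 0 < σ) (ξ : ℝ) :
    charFun (occLaw δ σ) ξ = Complex.exp (-∑' n : ℕ, driftRatio δ σ •
      ((1 - Complex.exp (-((-(ξ * Complex.I)) * (driftRatio δ σ * (n + 1) : ℝ)))) /
        (driftRatio δ σ * (n + 1) : ℝ) * (gaussTail (driftRatio δ σ * (n + 1)) : ℂ))) := by
  have hq := driftRatio_pos hδ.ne' hσ
  have hs := summable_negProb hδ hσ
  have hs' := summable_negProb_div _ hs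
  rw [charFun_apply_real, occLaw, integral_map (measurable_mul_pathOcc _).aemeasurable
    (by fun_prop : Continuous fun x : ℝ => Complex.exp (ξ * x * Complex.I)).aestronglyMeasurable]
  have h := integral_exp_pathOcc (gaussianReal δ (σ ^ 2)) hs (ξ * driftRatio δ σ)
  have h1 : ∀ x, Complex.exp (ξ * (driftRatio δ σ * (pathOcc x).toReal : ℝ) * Complex.I) =
      Complex.exp (((pathOcc x).toReal : ℂ) * ((ξ * driftRatio δ σ : ℝ) * Complex.I)) := by
    intro x; congr 1; push_cast; ring
  simp_rw [h1]
  rw [h, spitzerSeries, spitzerSeries, ← neg_sub]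
  have hsum : ∀ w : ℂ, ‖w‖ = 1 → Summable fun n : ℕ =>
      ((negProb (gaussianReal δ (σ ^ 2)) n / n : ℝ) : ℂ) * w ^ n := by
    intro w hw
    refine Summable.of_norm (hs'.abs.congr fun n => ?_)
    rw [norm_mul, norm_pow, hw, one_pow, mul_one, Complex.norm_real, Real.norm_eq_abs]
  have hw := Complex.norm_exp_ofReal_mul_I (ξ * driftRatio δ σ)
  rw [← (hsum 1 norm_one).tsum_sub (hsum _ hw),
    ((hsum 1 norm_one).sub (hsum _ hw)).tsum_eq_zero_add]
  simp only [CharP.cast_eq_zero, div_zero, Complex.ofReal_zero, zero_mul, sub_zero, zero_add]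
  congr 2
  refine tsum_congr fun n => ?_
  rw [negProb_of_pos hδ hσ (by omega), ← Complex.exp_nat_mul, Complex.real_smul]
  have hq' : (driftRatio δ σ : ℂ) ≠ 0 := by exact_mod_cast hq.ne'
  have hn : (n : ℂ) + 1 ≠ 0 := by exact_mod_cast n.succ_ne_zero
  have he : ((n + 1 : ℕ) : ℂ) * ((ξ * driftRatio δ σ : ℝ) * Complex.I) =
      -(-(ξ * Complex.I) * (driftRatio δ σ * (n + 1) : ℝ)) := by push_cast; ring
  rw [he, one_pow]
  push_cast
  field_simp

end

lemma charFun_lawA (ξ : ℝ) :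
    charFun lawA ξ = Complex.exp (-limitExponent (-(ξ * Complex.I))) := by
  rw [exp_neg_limitExponent (by simp), charFun_apply_real]
  congr 1
  ext t
  congr 1
  ring

instance : IsProbabilityMeasure lawA := isProbabilityMeasure_lawA

/-- The parameters δ = √(2q), σ = 1 serve as representatives of each drift ratio, making the limit a
one-parameter problem. -/
lemma driftRatio_sqrt_one {q : ℝ} (hq : 0 ≤ q) : driftRatio (√(2 * q)) 1 = q := by
  rw [driftRatio, Real.sq_sqrt (by linarith)]
  simp

/-- The law of the normalized occupation time depends on the parameters only through the drift
ratio. -/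
lemma occLaw_eq {δ : ℝ} {σ : ℝ≥0} (hδ : 0 < δ) (hσ : 0 < σ) :
    occLaw δ σ = occLaw (√(2 * driftRatio δ σ)) 1 := by
  have hq := driftRatio_pos hδ.ne' hσ
  refine Measure.ext_of_charFun ?_
  ext ξ
  rw [charFun_occLaw hδ hσ, charFun_occLaw (by positivity) one_pos, driftRatio_sqrt_one hq.le]

lemma tendsto_occLaw :
    Tendsto (β := ProbabilityMeasure ℝ) (fun q => ⟨occLaw (√(2 * q)) 1, inferInstance⟩) (𝓝[>] 0)
      (𝓝 ⟨lawA, inferInstance⟩) := by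
  -- Lévy's theorem is applied along sequences. They suffice at 𝓝[>] 0, which is countably
  -- generated, as a general index filter need not be.
  refine tendsto_of_seq_tendsto fun u hu => ?_
  refine ProbabilityMeasure.tendsto_of_tendsto_charFun fun ξ => ?_
  have hR := tendsto_riemann_sum
    (f := fun t : ℝ => (1 - Complex.exp (-((-(ξ * Complex.I)) * t))) / t * (gaussTail t : ℂ))
    (g := fun t => |ξ| * gaussTail t)
    ((antitone_gaussTail.const_mul (abs_nonneg ξ)).antitoneOn _)
    (integrableOn_gaussTail.const_mul _) (fun t ht => integrand_norm_le ξ ht)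
    (by
      refine ContinuousOn.mul (ContinuousOn.div (by fun_prop) (by fun_prop) fun t ht => ?_)
        (Complex.continuous_ofReal.comp_continuousOn
          (continuousOn_gaussTail.mono Ioi_subset_Ici_self))
      exact_mod_cast (ne_of_gt ht))
  have h1 := ((Complex.continuous_exp.tendsto _).comp (hR.neg)).comp hu
  change Tendsto (fun n => charFun (occLaw (√(2 * u n)) 1) ξ) atTop (𝓝 (charFun lawA ξ))
  rw [charFun_lawA]
  refine h1.congr' ?_
  filter_upwards [hu.eventually self_mem_nhdsWithin] with n hn
  have hn0 : 0 < u n := hn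
  rw [charFun_occLaw (by positivity) one_pos, driftRatio_sqrt_one hn0.le]
  rfl

section

variable {Ω : Type*} [MeasurableSpace Ω] {P : Measure Ω} {X : ℕ → Ω → ℝ} {δ : ℝ} {σ : ℝ≥0}

lemma occupationTime_lt_top (hδ : 0 < δ) (hσ : 0 < σ) (h : IsNormalSteps P X δ σ) :
    ∀ᵐ ω ∂P, occupationTime X ω < ∞ := by
  have h1 := pathOcc_lt_top _ (summable_negProb hδ hσ)
  rw [← h.hasLaw.map_eq] at h1
  exact ae_of_ae_map h.hasLaw.aemeasurable h1

lemma hasLaw_occupationTime (h : IsNormalSteps P X δ σ) :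
    HasLaw (fun ω => driftRatio δ σ * (occupationTime X ω).toReal) (occLaw δ σ) P := by
  have hm := measurable_mul_pathOcc (driftRatio δ σ)
  refine ⟨hm.comp_aemeasurable h.hasLaw.aemeasurable, ?_⟩
  rw [occLaw, ← h.hasLaw.map_eq, AEMeasurable.map_map_of_aemeasurable hm.aemeasurable
    h.hasLaw.aemeasurable]
  rfl

end

lemma tendsto_driftRatio_pos {ι : Type*} {l : Filter ι} {δ : ι → ℝ} {σ : ι → ℝ≥0}
    (hδ : ∀ i, δ i ≠ 0) (hσ : ∀ i, 0 < σ i)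
    (h : Tendsto (fun i => driftRatio (δ i) (σ i)) l (𝓝 0)) :
    Tendsto (fun i => driftRatio (δ i) (σ i)) l (𝓝[>] 0) :=
  tendsto_nhdsWithin_iff.2 ⟨h, Eventually.of_forall fun i => driftRatio_pos (hδ i) (hσ i)⟩

lemma tendstoInDistribution_occupationTime {ι : Type*} {l : Filter ι} {Ω : ι → Type*}
    [∀ i, MeasurableSpace (Ω i)] {P : ∀ i, Measure (Ω i)} [∀ i, IsProbabilityMeasure (P i)]
    {X : ∀ i, ℕ → Ω i → ℝ} {δ : ι → ℝ} {σ : ι → ℝ≥0} (hδ : ∀ i, 0 < δ i) (hσ : ∀ i, 0 < σ i)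
    (hX : ∀ i, IsNormalSteps (P i) (X i) (δ i) (σ i))
    (h : Tendsto (fun i => driftRatio (δ i) (σ i)) l (𝓝 0))
    {Ω' : Type*} [MeasurableSpace Ω'] {P' : Measure Ω'} [IsProbabilityMeasure P']
    {A : Ω' → ℝ} (hA : HasLaw A lawA P') :
    TendstoInDistribution
      (fun i ω => driftRatio (δ i) (σ i) * (occupationTime (X i) ω).toReal) l A P P' := by
  refine ⟨fun i => (hasLaw_occupationTime (hX i)).aemeasurable, hA.aemeasurable, ?_⟩
  have h1 := tendsto_occLaw.comp (tendsto_driftRatio_pos (fun i => (hδ i).ne') hσ h)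
  have h2 : (⟨P'.map A, Measure.isProbabilityMeasure_map hA.aemeasurable⟩ :
      ProbabilityMeasure ℝ) = ⟨lawA, inferInstance⟩ := Subtype.ext hA.map_eq
  rw [h2]
  refine h1.congr fun i => Subtype.ext ?_
  change occLaw _ _ = (P i).map _
  rw [(hasLaw_occupationTime (hX i)).map_eq, occLaw_eq (hδ i) (hσ i)]

/-! ### Negative drift -/

lemma integrableOn_rpow_mul_exp {s : ℝ} (hs : 0 < s) :
    IntegrableOn (fun t : ℝ => t ^ (-(1 / 2) : ℝ) * Real.exp (-s * t)) (Ioi 0) := by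
  have := integrableOn_rpow_mul_exp_neg_mul_rpow (p := 1) (s := -(1 / 2)) (b := s) (by norm_num)
    one_pos hs
  simpa using this

lemma half_sub_gaussTail_div {t : ℝ} (ht : 0 < t) :
    (1 / 2 - gaussTail t) / t = (√Real.pi)⁻¹ * t ^ (-(1 / 2) : ℝ) *
      ∫ x in Ioo (0 : ℝ) 1, Real.exp (-(x ^ 2 * t)) := by
  have hpi := Real.pi_pos
  rw [half_sub_gaussTail ht.le, Real.sqrt_div' _ hpi.le, Real.rpow_neg ht.le, ← Real.sqrt_eq_rpow]
  have h1 := Real.mul_self_sqrt ht.le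
  have h2 : 0 < √t := Real.sqrt_pos.2 ht
  generalize ∫ x in Ioo (0 : ℝ) 1, Real.exp (-(x ^ 2 * t)) = I
  generalize √t = r at *
  subst h1
  field_simp

/-- The majorant has an integrable singularity at 0 and is nonincreasing when s > 0, as the Riemann
sum argument needs. -/
lemma half_sub_gaussTail_div_mul_exp_le {s t : ℝ} (ht : 0 < t) :
    ‖(1 / 2 - gaussTail t) / t * Real.exp (-s * t)‖ ≤
      t ^ (-(1 / 2) : ℝ) * Real.exp (-s * t) := by
  have h0 : 0 ≤ (1 / 2 - gaussTail t) / t :=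
    div_nonneg (by linarith [gaussTail_le_half t]) ht.le
  rw [Real.norm_of_nonneg (mul_nonneg h0 (Real.exp_pos _).le)]
  refine mul_le_mul_of_nonneg_right ?_ (Real.exp_pos _).le
  rw [half_sub_gaussTail_div ht]
  have hI : ∫ x in Ioo (0 : ℝ) 1, Real.exp (-(x ^ 2 * t)) ≤ 1 := by
    have h1 : ∫ x in Ioo (0 : ℝ) 1, (1 : ℝ) = 1 := by simp
    have hc : Continuous fun x : ℝ => Real.exp (-(x ^ 2 * t)) := by fun_prop
    refine (integral_mono ((hc.integrableOn_Icc (a := 0) (b := 1)).mono_set Ioo_subset_Icc_self)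
      (by simp) fun x => Real.exp_le_one_iff.2 ?_).trans h1.le
    have := mul_nonneg (sq_nonneg x) ht.le
    linarith
  have hsp : (√Real.pi)⁻¹ ≤ 1 :=
    inv_le_one_of_one_le₀ (Real.one_le_sqrt.2 (by linarith [Real.pi_gt_three]))
  have hr : 0 ≤ t ^ (-(1 / 2) : ℝ) := Real.rpow_nonneg ht.le _
  have hI0 : 0 ≤ ∫ x in Ioo (0 : ℝ) 1, Real.exp (-(x ^ 2 * t)) :=
    setIntegral_nonneg measurableSet_Ioo fun x _ => (Real.exp_pos _).le
  calc _ ≤ 1 * t ^ (-(1 / 2) : ℝ) * 1 := by gcongr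
    _ = _ := by ring

/-- The limit exponent for negative drift. -/
lemma integral_half_sub_gaussTail {s : ℝ} (hs : 0 < s) :
    ∫ t in Ioi (0 : ℝ), (1 / 2 - gaussTail t) / t * Real.exp (-s * t) =
      Real.arsinh (√s)⁻¹ := by
  have hpi := Real.pi_pos
  have hss : 0 < √s := Real.sqrt_pos.2 hs
  have h1 : ∫ t in Ioi (0 : ℝ), (1 / 2 - gaussTail t) / t * Real.exp (-s * t) =
      ∫ t in Ioi (0 : ℝ), ∫ x in Ioo (0 : ℝ) 1,
        (√Real.pi)⁻¹ * (Real.exp (-(x ^ 2 * t)) * (t ^ (-(1 / 2) : ℝ) * Real.exp (-s * t))) := by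
    refine setIntegral_congr_fun measurableSet_Ioi fun t ht => ?_
    simp only [half_sub_gaussTail_div ht]
    rw [integral_const_mul, integral_mul_const]
    ring
  have hint : Integrable (Function.uncurry fun t x : ℝ =>
      (√Real.pi)⁻¹ * (Real.exp (-(x ^ 2 * t)) * (t ^ (-(1 / 2) : ℝ) * Real.exp (-s * t))))
      ((volume.restrict (Ioi 0)).prod (volume.restrict (Ioo 0 1))) := by
    refine Integrable.const_mul ?_ _
    refine Integrable.bdd_mul (c := 1)
      ((integrableOn_rpow_mul_exp hs).comp_fst (volume.restrict (Ioo (0 : ℝ) 1)))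
      (by fun_prop : Continuous fun p : ℝ × ℝ =>
        Real.exp (-(p.2 ^ 2 * p.1))).aestronglyMeasurable ?_
    rw [Measure.prod_restrict]
    filter_upwards [ae_restrict_mem (measurableSet_Ioi.prod measurableSet_Ioo)] with p hp
    rw [Real.norm_of_nonneg (Real.exp_pos _).le, Real.exp_le_one_iff]
    have := mul_nonneg (sq_nonneg p.2) (le_of_lt hp.1)
    linarith
  -- After the swap the t-integral is Γ(1/2)/√(π(s+x²)), and 1/√(s+x²) has primitive arsinh(x/√s).
  have hinner : ∀ x : ℝ, ∫ t in Ioi (0 : ℝ),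
      (√Real.pi)⁻¹ * (Real.exp (-(x ^ 2 * t)) * (t ^ (-(1 / 2) : ℝ) * Real.exp (-s * t))) =
      (√(s + x ^ 2))⁻¹ := by
    intro x
    have hr : 0 < s + x ^ 2 := by positivity
    have h2 := Real.integral_rpow_mul_exp_neg_mul_Ioi (a := 1 / 2) (by norm_num) hr
    rw [Real.Gamma_one_half_eq] at h2
    have h3 : ∀ t : ℝ, Real.exp (-(x ^ 2 * t)) * (t ^ (-(1 / 2) : ℝ) * Real.exp (-s * t)) =
        t ^ ((1 / 2 : ℝ) - 1) * Real.exp (-((s + x ^ 2) * t)) := by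
      intro t
      rw [show (1 / 2 : ℝ) - 1 = -(1 / 2) by norm_num, mul_left_comm, ← Real.exp_add]
      congr 2
      ring
    simp_rw [h3]
    rw [integral_const_mul, h2, ← Real.sqrt_eq_rpow, one_div, Real.sqrt_inv]
    field_simp
  have hderiv : ∀ x : ℝ, HasDerivAt (fun x => Real.arsinh (x / √s)) (√(s + x ^ 2))⁻¹ x := by
    intro x
    have h2 := (Real.hasDerivAt_arsinh (x / √s)).comp x ((hasDerivAt_id x).div_const (√s))
    convert! h2 using 1
    have h3 : s + x ^ 2 = s * (1 + (x / √s) ^ 2) := by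
      rw [div_pow, Real.sq_sqrt hs.le]; field_simp
    rw [h3, Real.sqrt_mul hs.le, mul_inv, one_div, mul_comm]
  rw [h1, integral_integral_swap hint]
  simp_rw [hinner]
  rw [← integral_Ioc_eq_integral_Ioo, ← intervalIntegral.integral_of_le zero_le_one,
    intervalIntegral.integral_eq_sub_of_hasDerivAt (fun x _ => hderiv x)]
  · simp
  · refine Continuous.intervalIntegrable ?_ 0 1
    refine Continuous.inv₀ (by fun_prop) fun x => ?_
    positivity

/-- The real version of `coreSeries` at `e^{-qs}`. -/
lemma tendsto_core {s : ℝ} (hs : 0 < s) :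
    Tendsto (fun q : ℝ => ∑' n : ℕ, (1 / 2 - gaussTail (q * n)) / n * Real.exp (-(q * s)) ^ n)
      (𝓝[>] 0) (𝓝 (Real.arsinh (√s)⁻¹)) := by
  have h := tendsto_riemann_sum
    (f := fun t : ℝ => (1 / 2 - gaussTail t) / t * Real.exp (-s * t))
    (g := fun t : ℝ => t ^ (-(1 / 2) : ℝ) * Real.exp (-s * t)) ?_ (integrableOn_rpow_mul_exp hs)
    (fun t ht => half_sub_gaussTail_div_mul_exp_le ht) ?_
  · rw [integral_half_sub_gaussTail hs] at h
    refine h.congr' ?_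
    filter_upwards [self_mem_nhdsWithin] with q hq
    have hq0 : 0 < q := hq
    have hz : ‖((Real.exp (-(q * s)) : ℝ) : ℂ)‖ < 1 := by
      rw [Complex.norm_real, Real.norm_of_nonneg (Real.exp_pos _).le]
      exact Real.exp_lt_one_iff.2 (by have := mul_pos hq0 hs; linarith)
    have hsum : Summable fun n : ℕ =>
        (1 / 2 - gaussTail (q * n)) / n * Real.exp (-(q * s)) ^ n := by
      have := summable_coreSeries q hz
      exact_mod_cast this
    rw [hsum.tsum_eq_zero_add]
    simp only [CharP.cast_eq_zero, div_zero, zero_mul, zero_add, smul_eq_mul]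
    refine tsum_congr fun n => ?_
    rw [← Real.exp_nat_mul]
    push_cast
    have : (n : ℝ) + 1 ≠ 0 := by positivity
    rw [show (n + 1 : ℝ) * -(q * s) = -s * (q * (n + 1)) by ring]
    field_simp
  · intro a ha b hb hab
    have ha0 : (0 : ℝ) < a := ha
    have := Real.rpow_nonneg (le_of_lt hb) (-(1 / 2))
    refine mul_le_mul (Real.rpow_le_rpow_of_nonpos ha0 hab (by norm_num))
      (Real.exp_le_exp.2 ?_) (Real.exp_pos _).le (Real.rpow_nonneg ha0.le _)
    nlinarith
  · refine ContinuousOn.mul (ContinuousOn.div ?_ continuousOn_id fun t ht => ne_of_gt ht)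
      (by fun_prop)
    exact continuousOn_const.sub (continuousOn_gaussTail.mono Ioi_subset_Ici_self)

section

variable {Ω : Type*} [MeasurableSpace Ω] {P : Measure Ω} {X : ℕ → Ω → ℝ} {δ : ℝ} {σ : ℝ≥0}

lemma epochGenFun_real_of_neg (hδ : δ < 0) (hσ : 0 < σ) (h : IsNormalSteps P X δ σ) {z : ℝ}
    (hz0 : 0 ≤ z) (hz1 : z < 1) :
    epochGenFun P X z = 1 - √(1 - z) *
      Real.exp (-∑' n : ℕ, (1 / 2 - gaussTail (driftRatio δ σ * n)) / n * z ^ n) := by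
  have hz : ‖(z : ℂ)‖ < 1 := by
    rwa [Complex.norm_real, Real.norm_of_nonneg hz0]
  have h1 := tsum_epochProb_gaussian hδ.ne hσ hz
  rw [epochGenFun_eq h]
  have h2 : ((1 : ℂ) - z) ^ (1 / 2 : ℂ) = (√(1 - z) : ℝ) := by
    rw [Real.sqrt_eq_rpow, Complex.ofReal_cpow (by linarith)]
    push_cast
    rfl
  rw [h2, Real.sign_of_neg hδ, coreSeries] at h1
  have h3 : ((∑' n : ℕ, epochProb (gaussianReal δ (σ ^ 2)) n * z ^ n : ℝ) : ℂ) =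
      ((1 - √(1 - z) * Real.exp
        (-∑' n : ℕ, (1 / 2 - gaussTail (driftRatio δ σ * n)) / n * z ^ n) : ℝ) : ℂ) := by
    push_cast
    rw [h1]
    push_cast
    simp
  exact_mod_cast h3

/-- The partial sums of P(R = n) telescope to 1 - v_N, and v_N ≤ P(S_N ≥ 0) = Φ(-√(2qN)) → 0. -/
lemma epochGenFun_one_of_neg (hδ : δ < 0) (hσ : 0 < σ) (h : IsNormalSteps P X δ σ) :
    epochGenFun P X (1 : ℝ) = 1 := by
  rw [epochGenFun_eq h]
  simp only [one_pow, mul_one]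
  set μ := gaussianReal δ (σ ^ 2)
  have hv : Tendsto (stayProb μ) atTop (𝓝 0) := by
    have ht := (summable_gaussTail (driftRatio_pos hδ.ne hσ)).tendsto_atTop_zero
    refine squeeze_zero' (Eventually.of_forall fun n => measureReal_nonneg) ?_ ht
    filter_upwards [eventually_ge_atTop 1] with n hn
    have h1 := negProb_of_neg hδ hσ hn
    have h2 : stayProb μ n ≤ 1 - negProb μ n := by
      rw [negProb, ← probReal_compl_eq_one_sub
        (measurableSet_lt (measurable_psum n) measurable_const)]
      exact measureReal_mono fun x hx => not_lt.2 (hx n le_rfl)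
    linarith
  refine ((hasSum_iff_tendsto_nat_of_nonneg (fun n => measureReal_nonneg) 1).2 ?_).tsum_eq
  rw [← tendsto_add_atTop_iff_nat 1]
  have hsum : ∀ N, ∑ i ∈ Finset.range (N + 1), epochProb μ i = 1 - stayProb μ N := by
    intro N
    rw [Finset.sum_range_succ', epochProb_zero, add_zero]
    simp_rw [epochProb_succ]
    rw [Finset.sum_range_sub', stayProb_zero]
  have h1 : Tendsto (fun N => 1 - stayProb μ N) atTop (𝓝 1) := by simpa using hv.const_sub 1
  exact h1.congr fun N => (hsum N).symm

end

lemma tendsto_epoch_limit {s : ℝ} (hs : 0 < s) :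
    Tendsto (fun q : ℝ => (1 - √(1 - Real.exp (-(q * s))) * Real.exp
        (-∑' n : ℕ, (1 / 2 - gaussTail (q * n)) / n * Real.exp (-(q * s)) ^ n)) ^ (1 / √q))
      (𝓝[>] 0) (𝓝 (Real.exp (-(√(1 + s) - 1)))) := by
  set C : ℝ → ℝ := fun q =>
    ∑' n : ℕ, (1 / 2 - gaussTail (q * n)) / n * Real.exp (-(q * s)) ^ n with hC
  have hss : 0 < √s := Real.sqrt_pos.2 hs
  have hlim : Tendsto (fun q : ℝ => 1 / √q * -(√(1 - Real.exp (-(q * s))) * Real.exp (-C q)))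
      (𝓝[>] 0) (𝓝 (-(√(1 + s) - 1))) := by
    have hslope : Tendsto (fun q : ℝ => (1 - Real.exp (-(q * s))) / q) (𝓝[>] 0) (𝓝 s) := by
      have hd : HasDerivAt (fun q : ℝ => 1 - Real.exp (-(q * s))) s 0 := by
        have := (((hasDerivAt_id (0 : ℝ)).mul_const s).neg.exp).const_sub 1
        simpa using this
      have := hd.tendsto_slope_zero_right
      refine this.congr fun q => ?_
      simp [div_eq_inv_mul]
    have hE : Tendsto (fun q => Real.exp (-C q)) (𝓝[>] 0)
        (𝓝 (Real.exp (-Real.arsinh (√s)⁻¹))) :=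
      (Real.continuous_exp.tendsto _).comp (tendsto_core hs).neg
    have hprod := ((Real.continuous_sqrt.tendsto s).comp hslope).mul hE
    -- Since e^{arsinh y} = y + √(1+y²), the left side is s/(1 + √(1+s)).
    have hval : √s * Real.exp (-Real.arsinh (√s)⁻¹) = √(1 + s) - 1 := by
      rw [Real.exp_neg, Real.exp_arsinh]
      have h1 : 1 + ((√s)⁻¹) ^ 2 = (1 + s) / s := by
        rw [inv_pow, Real.sq_sqrt hs.le]; field_simp; ring
      rw [h1, Real.sqrt_div' _ hs.le]
      have h2 := Real.mul_self_sqrt hs.le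
      have h3 := Real.mul_self_sqrt (show 0 ≤ 1 + s by linarith)
      have h4 : 0 < √(1 + s) := Real.sqrt_pos.2 (by linarith)
      have h5 : 0 < 1 + √(1 + s) := by linarith
      field_simp
      linear_combination h2 - h3
    rw [hval] at hprod
    refine hprod.neg.congr' ?_
    filter_upwards [self_mem_nhdsWithin] with q hq
    have hq0 : (0 : ℝ) < q := hq
    simp only [Function.comp_apply]
    rw [Real.sqrt_div' _ hq0.le]
    ring
  have hinv : Tendsto (fun x : ℝ => 1 / x ^ 2) atTop (𝓝[>] 0) := by
    refine tendsto_nhdsWithin_iff.2 ⟨?_, ?_⟩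
    · exact (tendsto_pow_atTop (α := ℝ) two_ne_zero).inv_tendsto_atTop.congr fun x =>
        (one_div _).symm
    · filter_upwards [eventually_gt_atTop 0] with x hx
      simp only [mem_Ioi]
      positivity
  have hsq : Tendsto (fun q : ℝ => 1 / √q) (𝓝[>] 0) atTop := by
    have h1 : Tendsto (fun q : ℝ => √q) (𝓝[>] 0) (𝓝[>] 0) := by
      refine tendsto_nhdsWithin_iff.2 ⟨?_, ?_⟩
      · simpa using (Real.continuous_sqrt.tendsto 0).mono_left (nhdsWithin_le_nhds (s := Ioi 0))
      · filter_upwards [self_mem_nhdsWithin] with q hq using Real.sqrt_pos.2 hq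
    exact (tendsto_inv_nhdsGT_zero.comp h1).congr fun q => (one_div _).symm
  -- The limit of (1 + g(x))^x as x → ∞ is used with x = 1/√q, that is q = 1/x².
  have hpow := Real.tendsto_one_add_rpow_exp_of_tendsto
    (g := fun x => -(√(1 - Real.exp (-(1 / x ^ 2 * s))) * Real.exp (-C (1 / x ^ 2)))) (by
      refine (hlim.comp hinv).congr' ?_
      filter_upwards [eventually_gt_atTop 0] with x hx
      simp only [Function.comp_apply]
      rw [Real.sqrt_div zero_le_one, Real.sqrt_one, Real.sqrt_sq hx.le, one_div_one_div])
  refine (hpow.comp hsq).congr' ?_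
  filter_upwards [self_mem_nhdsWithin] with q hq
  have hq0 : (0 : ℝ) < q := hq
  have : 1 / (1 / √q) ^ 2 = q := by
    rw [div_pow, Real.sq_sqrt hq0.le]; field_simp
  simp only [Function.comp_apply, this]
  rw [← sub_eq_add_neg]

lemma tendsto_epochGenFun_of_neg {ι : Type*} {l : Filter ι} {Ω : ι → Type*}
    [∀ i, MeasurableSpace (Ω i)] {P : ∀ i, Measure (Ω i)}
    {X : ∀ i, ℕ → Ω i → ℝ} {δ : ι → ℝ} {σ : ι → ℝ≥0} (hδ : ∀ i, δ i < 0) (hσ : ∀ i, 0 < σ i)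
    (hX : ∀ i, IsNormalSteps (P i) (X i) (δ i) (σ i))
    (h : Tendsto (fun i => driftRatio (δ i) (σ i)) l (𝓝 0)) {s : ℝ} (hs : 0 ≤ s) :
    Tendsto (fun i => epochGenFun (P i) (X i) (Real.exp (-(driftRatio (δ i) (σ i) * s))) ^
      (1 / √(driftRatio (δ i) (σ i)))) l (𝓝 (Real.exp (-(√(1 + s) - 1)))) := by
  -- At s = 0 the argument is z = 1, outside the open disc where the formula holds; there r(1) = 1
  -- is used instead.
  rcases hs.eq_or_lt with rfl | hs
  · simp only [mul_zero, neg_zero, Real.exp_zero, epochGenFun_one_of_neg (hδ _) (hσ _) (hX _),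
      Real.one_rpow, add_zero, Real.sqrt_one, sub_self]
    exact tendsto_const_nhds
  · refine ((tendsto_epoch_limit hs).comp
      (tendsto_driftRatio_pos (fun i => (hδ i).ne) hσ h)).congr fun i => ?_
    have hq := mul_pos (driftRatio_pos (hδ i).ne (hσ i)) hs
    rw [epochGenFun_real_of_neg (hδ i) (hσ i) (hX i) (Real.exp_pos _).le
      (Real.exp_lt_one_iff.2 (by linarith))]
    rfl

end NormalWalk

end

theorem mainTheorem6 :
    -- (a) the explicit formula for the generating function of the ladder epoch
    (∀ {Ω : Type*} [MeasurableSpace Ω] (P : Measure Ω) [IsProbabilityMeasure P]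
        (X : ℕ → Ω → ℝ) (δ : ℝ) (σ : ℝ≥0), δ ≠ 0 → 0 < σ →
        NormalWalk.IsNormalSteps P X δ σ → ∀ z : ℂ, ‖z‖ < 1 →
          IntegrableOn (fun p : ℝ × ℝ => NormalWalk.kernelG δ σ z p.1 p.2)
            (Ioo (0 : ℝ) 1 ×ˢ Ioi (0 : ℝ)) ∧
          NormalWalk.epochGenFun P X z =
            1 - (1 - z) ^ (1 / 2 : ℂ) *
              Complex.exp ((Real.sign δ : ℂ) * NormalWalk.funG δ σ z)) ∧
    -- the law of `A` is a probability measure with Laplace transform `2 / (1 + √(1 + s))`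
    (IsProbabilityMeasure NormalWalk.lawA ∧
      ∀ s : ℝ, 0 ≤ s → ∫ t, Real.exp (-s * t) ∂NormalWalk.lawA = 2 / (1 + √(1 + s))) ∧
    -- (b) for positive drift, `Z₀` is almost surely finite and `q Z₀ → A` in distribution
    (∀ {ι : Type*} (l : Filter ι) {Ω : ι → Type*} [∀ i, MeasurableSpace (Ω i)]
        (P : ∀ i, Measure (Ω i)) [∀ i, IsProbabilityMeasure (P i)]
        (X : ∀ i, ℕ → Ω i → ℝ) (δ : ι → ℝ) (σ : ι → ℝ≥0),
        (∀ i, 0 < δ i) → (∀ i, 0 < σ i) →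
        (∀ i, NormalWalk.IsNormalSteps (P i) (X i) (δ i) (σ i)) →
        Tendsto (fun i => NormalWalk.driftRatio (δ i) (σ i)) l (𝓝 0) →
        (∀ i, ∀ᵐ ω ∂(P i), NormalWalk.occupationTime (X i) ω < ∞) ∧
        ∀ {Ω' : Type*} [MeasurableSpace Ω'] (P' : Measure Ω') [IsProbabilityMeasure P']
          (A : Ω' → ℝ), HasLaw A NormalWalk.lawA P' →
          TendstoInDistribution
            (fun i ω => NormalWalk.driftRatio (δ i) (σ i) *
              (NormalWalk.occupationTime (X i) ω).toReal) l A P P') ∧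
    -- (c) the limit for negative drift
    (∀ {ι : Type*} (l : Filter ι) {Ω : ι → Type*} [∀ i, MeasurableSpace (Ω i)]
        (P : ∀ i, Measure (Ω i)) [∀ i, IsProbabilityMeasure (P i)]
        (X : ∀ i, ℕ → Ω i → ℝ) (δ : ι → ℝ) (σ : ι → ℝ≥0),
        (∀ i, δ i < 0) → (∀ i, 0 < σ i) →
        (∀ i, NormalWalk.IsNormalSteps (P i) (X i) (δ i) (σ i)) →
        Tendsto (fun i => NormalWalk.driftRatio (δ i) (σ i)) l (𝓝 0) →
        ∀ s : ℝ, 0 ≤ s →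
          Tendsto
            (fun i => NormalWalk.epochGenFun (P i) (X i)
                (Real.exp (-(NormalWalk.driftRatio (δ i) (σ i) * s))) ^
              (1 / √(NormalWalk.driftRatio (δ i) (σ i)))) l
            (𝓝 (Real.exp (-(√(1 + s) - 1))))) := by
  refine ⟨?_, ⟨NormalWalk.isProbabilityMeasure_lawA, fun s hs => NormalWalk.integral_exp_lawA hs⟩,
    ?_, ?_⟩
  · intro Ω _ P _ X δ σ hδ hσ hX z hz
    exact ⟨NormalWalk.integrableOn_kernelG hδ hσ hz, NormalWalk.epochGenFun_complex hδ hσ hX hz⟩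
  · intro ι l Ω _ P _ X δ σ hδ hσ hX h
    refine ⟨fun i => NormalWalk.occupationTime_lt_top (hδ i) (hσ i) (hX i), ?_⟩
    intro Ω' _ P' _ A hA
    exact NormalWalk.tendstoInDistribution_occupationTime hδ hσ hX h hA
  · intro ι l Ω _ P _ X δ σ hδ hσ hX h s hs
    exact NormalWalk.tendsto_epochGenFun_of_neg hδ hσ hX h hs
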